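/- Let $d\ge 1$ and let $U:\mathbb{R}^d\to\mathbb{R}$ be twice continuously differentiable, bounded from below and normalized so that $U\ge 1$, with bounded Hessian: $m:=\|\nabla^2U\|_\infty=\sup_x\|\nabla^2U(x)\|<\infty$ (operator norm). Let $0<\epsilon<\frac1{4m}$ (in particular $m>0$), let $g_\epsilon(z)=e^{-|z|^2/(4\epsilon)}$, and let $$T_\epsilon f(x)=\frac{\int_{\mathbb{R}^d} g_\epsilon(x-y)e^{-U(y)}f(y)\,dy}{\int_{\mathbb{R}^d} g_\epsilon(x-y)e^{-U(y)}\,dy},\qquad \pi(dx)=\gamma\, e^{-U(x)}\Big(\int_{\mathbb{R}^d} g_\epsilon(x-y)e^{-U(y)}\,dy\Big)dx,$$ where $\gamma$ is the normalization constant. For $\lambda_0,R>0$ put $\sigma^2=\frac{2\epsilon}{1+2m\epsilon}$ and $$b_0(\lambda_0,R)=d\,m+\max_{|x|\le R}\Big\{\lambda_0U(x)-\tfrac12|\nabla U(x)|^2\Big\},$$ $$\alpha(R)=\min_{|x|\le R}2^{-d/2}\,e^{-2\epsilon|\nabla U(x)|^2-3\epsilon d\,m-\frac{2}{\sigma^2}|x-\sigma^2\nabla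 U(x)|^2}.$$ (i) Suppose that $\lambda_0,R>0$ satisfy $$\tfrac12|\nabla U(x)|^2\ge\lambda_0U(x)+d\,m\qquad\text{for all }|x|\ge R.$$ Then $\pi$ is a probability measure, and, with $b_0=b_0(\lambda_0,R)$, $\alpha=\alpha(R)>0$ and $K=\{|x|\le R\}$, the operator $T_\epsilon$ satisfies the drift condition $$T_\epsilon U\le(1-\epsilon\lambda_0)U+\epsilon b_0\mathbf 1_K$$ (with $T_\epsilon U$ finite everywhere) and, for some probability measure $\nu$, the minorization condition $$T_\epsilon\mathbf 1_A(x)\ge\alpha\,\nu(A)\mathbf 1_K(x)\qquad\text{for all Borel sets }A\text{ and all }x.$$ Moreover, $T_\epsilon$ maps $L^2(\pi)$ to itself and has the spectral gap $$\|T_\epsilon\|_{L^2_0(\pi)}=\sup_{f\in L^2_0(\pi)}\frac{\|T_\epsilon f\|_{2,\pi}}{\|f\|_{2,\pi}}\le 1-\frac{\epsilon\lambda_0}{1+\frac{2\epsilon b_0}{\alpha}},\qquad \frac{\epsilon\lambda_0}{1+\frac{2\epsilon b_0}{\alpha}}>0,$$ where $L^2_0(\pi)=\{f\in L^2(\pi):\int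 f\,d\pi=0\}$. (ii) Suppose only that $\lambda_0,R>0$ satisfy $$\tfrac12|\nabla U(x)|^2\ge\lambda_0U(x)+m\qquad\text{for all }|x|\ge R.$$ Then $\pi$ is a probability measure, and for every $\lambda_1\in(0,\lambda_0)$ there is $r\ge R$ such that all conclusions of (i) hold with $(\lambda_0,R)$ replaced by $(\lambda_1,r)$. For $d=1$ the hypotheses of (i) and (ii) coincide, and the constants of (i) are $b_0=m+\max_{|x|\le R}\{\lambda_0U-\frac12|\nabla U|^2\}$ and $\alpha=\min_{|x|\le R}\frac1{\sqrt2}e^{-2\epsilon|\nabla U|^2-3\epsilon m-\frac2{\sigma^2}|x-\sigma^2\nabla U|^2}$. -/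

import Mathlib

open MeasureTheory
open scoped ENNReal Gradient

noncomputable section

namespace DiffusionMap

variable {d : ℕ}

/-- The Gaussian kernel `g_ε(z) = exp (-|z|² / (4ε))`. -/
def gaussKernel (ε : ℝ) (z : EuclideanSpace ℝ (Fin d)) : ℝ :=
  Real.exp (-(‖z‖ ^ 2) / (4 * ε))

/-- The weight `y ↦ g_ε(x - y) e^{-U(y)}`. -/
def weight (U : EuclideanSpace ℝ (Fin d) → ℝ) (ε : ℝ) (x y : EuclideanSpace ℝ (Fin d)) : ℝ :=
  gaussKernel ε (x - y) * Real.exp (-U y)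

/-- The diffusion map operator
`T_ε f (x) = (∫ g_ε(x-y) e^{-U(y)} f(y) dy) / (∫ g_ε(x-y) e^{-U(y)} dy)`. -/
def diffusionMap (U : EuclideanSpace ℝ (Fin d) → ℝ) (ε : ℝ)
    (f : EuclideanSpace ℝ (Fin d) → ℝ) (x : EuclideanSpace ℝ (Fin d)) : ℝ :=
  (∫ y, weight U ε x y * f y) / (∫ y, weight U ε x y)

/-- The unnormalized invariant density `e^{-U(x)} ∫ g_ε(x-y) e^{-U(y)} dy`. -/
def invDensity (U : EuclideanSpace ℝ (Fin d) → ℝ) (ε : ℝ) (x : EuclideanSpace ℝ (Fin d)) : ℝ :=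
  Real.exp (-U x) * ∫ y, weight U ε x y

/-- The invariant measure `π`: the measure with density `γ e^{-U(x)} ∫ g_ε(x-y) e^{-U(y)} dy`,
where `γ` is the normalization constant. -/
def invMeasure (U : EuclideanSpace ℝ (Fin d) → ℝ) (ε : ℝ) :
    Measure (EuclideanSpace ℝ (Fin d)) :=
  (∫⁻ x, ENNReal.ofReal (invDensity U ε x))⁻¹ •
    volume.withDensity (fun x => ENNReal.ofReal (invDensity U ε x))

/-- The Hessian `∇²U(x)`, as the linear operator `D(∇U)(x)`; its norm is the operator norm. -/
def hessian (U : EuclideanSpace ℝ (Fin d) → ℝ) (x : EuclideanSpace ℝ (Fin d)) :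
    EuclideanSpace ℝ (Fin d) →L[ℝ] EuclideanSpace ℝ (Fin d) :=
  fderiv ℝ (fun y => ∇ U y) x

/-- `‖∇²U‖_∞`, the supremum over `x` of the operator norms of the Hessian
(meaningful when these are bounded). -/
def hessSup (U : EuclideanSpace ℝ (Fin d) → ℝ) : ℝ :=
  ⨆ x, ‖hessian U x‖

/-- The drift condition `T_ε V ≤ (1-λ) V + b 1_K` and the minorization condition
`T_ε 1_A ≥ α ν(A) 1_K` for all Borel sets `A`, where `V ≥ 1`, `λ, α > 0` and `ν` is a probability
measure; `V` is integrable for each transition probability, so that `T_ε V` makes sense. -/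
structure LyapunovConditions (U : EuclideanSpace ℝ (Fin d) → ℝ) (ε : ℝ)
    (V : EuclideanSpace ℝ (Fin d) → ℝ) (lam b α : ℝ) (K : Set (EuclideanSpace ℝ (Fin d)))
    (ν : Measure (EuclideanSpace ℝ (Fin d))) : Prop where
  measurable_V : Measurable V
  one_le_V : ∀ x, 1 ≤ V x
  lam_pos : 0 < lam
  alpha_pos : 0 < α
  measurableSet_K : MeasurableSet K
  isProbabilityMeasure : IsProbabilityMeasure ν
  integrable_V : ∀ x, Integrable (fun y => weight U ε x y * V y)
  drift : ∀ x, diffusionMap U ε V x ≤ (1 - lam) * V x + b * K.indicator (fun _ => (1 : ℝ)) x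
  minorization : ∀ A : Set (EuclideanSpace ℝ (Fin d)), MeasurableSet A → ∀ x,
    α * ν.real A * K.indicator (fun _ => (1 : ℝ)) x
      ≤ diffusionMap U ε (A.indicator (fun _ => (1 : ℝ))) x

/-- The operator norm of `P` on `L²₀(π)`: the supremum of `‖P f‖_{2,π} / ‖f‖_{2,π}` over all
`f ∈ L²(π)` with `∫ f dπ = 0` (with `0 / 0 = 0`), as an extended nonnegative real. -/
def normL20 (π : Measure (EuclideanSpace ℝ (Fin d)))
    (P : (EuclideanSpace ℝ (Fin d) → ℝ) → (EuclideanSpace ℝ (Fin d) → ℝ)) : ℝ≥0∞ :=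
  ⨆ (f : EuclideanSpace ℝ (Fin d) → ℝ) (_ : MemLp f 2 π) (_ : ∫ x, f x ∂π = 0),
    eLpNorm (P f) 2 π / eLpNorm f 2 π

/-- `P` maps `L²(π)` to itself and has a spectral gap `β > 0`, i.e. `‖P‖_{L²₀(π)} ≤ 1 - β`. -/
structure HasSpectralGap (π : Measure (EuclideanSpace ℝ (Fin d)))
    (P : (EuclideanSpace ℝ (Fin d) → ℝ) → (EuclideanSpace ℝ (Fin d) → ℝ)) (β : ℝ) : Prop where
  beta_pos : 0 < β
  memLp : ∀ f, MemLp f 2 π → MemLp (P f) 2 π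
  norm_le : (normL20 π P : EReal) ≤ ((1 - β : ℝ) : EReal)

/-- `b₀ = d ‖∇²U‖_∞ + max_{|x| ≤ R} (λ₀ U(x) - |∇U(x)|² / 2)`. -/
def bZero (U : EuclideanSpace ℝ (Fin d) → ℝ) (lam0 R : ℝ) : ℝ :=
  d * hessSup U +
    sSup ((fun x => lam0 * U x - 1 / 2 * ‖∇ U x‖ ^ 2) '' Metric.closedBall 0 R)

/-- `σ² = 2ε / (1 + 2 ‖∇²U‖_∞ ε)`. -/
def sigmaSq (U : EuclideanSpace ℝ (Fin d) → ℝ) (ε : ℝ) : ℝ :=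
  2 * ε / (1 + 2 * hessSup U * ε)

/-- `α = min_{|x| ≤ R} 2^{-d/2} exp (-2ε|∇U(x)|² - 3ε d ‖∇²U‖_∞ - (2/σ²) |x - σ²∇U(x)|²)`. -/
def alphaMin (U : EuclideanSpace ℝ (Fin d) → ℝ) (ε R : ℝ) : ℝ :=
  sInf ((fun x => (1 / √2) ^ d * Real.exp (-2 * ε * ‖∇ U x‖ ^ 2 - 3 * ε * (d * hessSup U)
    - 2 / sigmaSq U ε * ‖x - sigmaSq U ε • ∇ U x‖ ^ 2)) '' Metric.closedBall 0 R)

end DiffusionMap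

end

/-! `T_ε` is the Markov operator of a kernel `κ` with density `weight U ε x y / ∫ weight`.
Multiplying this by the density of `π` cancels the normalization, so `π ⊗ₘ κ` has density
proportional to `e^{-U(x)} g_ε(x-y) e^{-U(y)}`. This is symmetric, so `κ` is reversible. It is also
positive definite, because a Gaussian kernel is the square of another one. Hence `⟨f, T_ε f⟩ ≥ 0`,
and the norm on `L²₀` is controlled by the top of the quadratic form. It remains to prove a Poincaré
inequality for `E(f) = ⟨f, (1 - T_ε) f⟩`.

With a drift condition of rate `λ` and constant `b`, testing against `f² / V` gives `λ ‖f‖² ≤ E(f) +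
b ∫_K f²`. Minorization gives `α ∫_K (f - c)² ≤ 2 E(f)` with `c = ∫ f dν`. Applying the first bound
to `f - c` yields `λ ‖f‖² ≤ (1 + 2b/α) E(f)` for mean zero `f`
(`poincare_of_drift_of_minorization`).

Drift and minorization come from the second-order Taylor bound for `U`, which squeezes the weight
between Gaussians whose integrals are explicit. For the drift with `V = U`, Jensen gives `T_ε U ≤
log (∫ g_ε / ∫ g_ε e^{-U})`, whence `T_ε U ≤ U + ε (d m - |∇U|²/2)` (`diffusionMap_le`). The
minorizing measure is a centered Gaussian (`alphaMin_mul_le_weight`).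

Dissipativity keeps `|∇U|` above `√λ₀` outside a ball, so `U` grows linearly. This makes `π` finite,
and in part (ii) lets `(λ₀ - λ₁) U` absorb `d m` far from the origin. -/

noncomputable section

namespace DiffusionMap

variable {d : ℕ}

/-! ### Reversible Markov kernels: from drift and minorization to a spectral gap -/

section Reversible

open ProbabilityTheory

variable {X : Type*} [MeasurableSpace X] {π : Measure X} [IsProbabilityMeasure π]
  {κ : Kernel X X} [IsMarkovKernel κ]

lemma _root_.MeasureTheory.Integrable.integral_measure_compProd {h : X × X → ℝ}
    (hh : Integrable h (π ⊗ₘ κ)) : Integrable (fun x => ∫ y, h (x, y) ∂(κ x)) π :=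
  hh.integral_compProd

lemma measurePreserving_fst_compProd : MeasurePreserving Prod.fst (π ⊗ₘ κ) π :=
  ⟨measurable_fst, Measure.fst_compProd π κ⟩

/-- Reversibility is expressed as invariance of the joint law under the swap; invariance of `π` is
the resulting equality of the two marginals. -/
lemma measurePreserving_snd_compProd (hrev : MeasurePreserving Prod.swap (π ⊗ₘ κ) (π ⊗ₘ κ)) :
    MeasurePreserving Prod.snd (π ⊗ₘ κ) π :=
  measurePreserving_fst_compProd.comp hrev

omit [IsProbabilityMeasure π] [IsMarkovKernel κ] in
lemma integral_comp_swap (hrev : MeasurePreserving Prod.swap (π ⊗ₘ κ) (π ⊗ₘ κ))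
    (h : X × X → ℝ) : ∫ p, h p.swap ∂(π ⊗ₘ κ) = ∫ p, h p ∂(π ⊗ₘ κ) :=
  hrev.integral_comp MeasurableEquiv.prodComm.measurableEmbedding h

lemma memLp_fst {f : X → ℝ} (hf : MemLp f 2 π) :
    MemLp (fun p : X × X => f p.1) 2 (π ⊗ₘ κ) :=
  hf.comp_measurePreserving measurePreserving_fst_compProd

lemma memLp_snd (hrev : MeasurePreserving Prod.swap (π ⊗ₘ κ) (π ⊗ₘ κ)) {f : X → ℝ}
    (hf : MemLp f 2 π) : MemLp (fun p : X × X => f p.2) 2 (π ⊗ₘ κ) :=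
  hf.comp_measurePreserving (measurePreserving_snd_compProd hrev)

lemma integrable_fst_mul_snd (hrev : MeasurePreserving Prod.swap (π ⊗ₘ κ) (π ⊗ₘ κ))
    {f g : X → ℝ} (hf : MemLp f 2 π) (hg : MemLp g 2 π) :
    Integrable (fun p : X × X => f p.1 * g p.2) (π ⊗ₘ κ) :=
  (memLp_fst hf).integrable_mul (memLp_snd hrev hg)

lemma integral_fst_compProd {f : X → ℝ} (hf : AEStronglyMeasurable f π) :
    ∫ p : X × X, f p.1 ∂(π ⊗ₘ κ) = ∫ x, f x ∂π := by
  have h := measurePreserving_fst_compProd (π := π) (κ := κ)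
  rw [← integral_map h.measurable.aemeasurable (by rwa [h.map_eq]), h.map_eq]

lemma integral_snd_compProd (hrev : MeasurePreserving Prod.swap (π ⊗ₘ κ) (π ⊗ₘ κ))
    {f : X → ℝ} (hf : AEStronglyMeasurable f π) :
    ∫ p : X × X, f p.2 ∂(π ⊗ₘ κ) = ∫ x, f x ∂π := by
  have h := measurePreserving_snd_compProd hrev
  rw [← integral_map h.measurable.aemeasurable (by rwa [h.map_eq]), h.map_eq]

/-- Fubini for `f(y)²`, which is integrable for the joint law because the second marginal is `π`. -/
lemma ae_memLp_kernel (hrev : MeasurePreserving Prod.swap (π ⊗ₘ κ) (π ⊗ₘ κ)) {f : X → ℝ}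
    (hf : MemLp f 2 π) : ∀ᵐ x ∂π, MemLp f 2 (κ x) := by
  have h1 := memLp_snd hrev hf
  have h2 := (Measure.integrable_compProd_iff h1.integrable_sq.aestronglyMeasurable).1
    h1.integrable_sq
  have h3 := (Measure.integrable_compProd_iff h1.aestronglyMeasurable).1
    (h1.integrable one_le_two)
  filter_upwards [h2.1, h3.1] with x hx hx'
  exact (memLp_two_iff_integrable_sq hx'.aestronglyMeasurable).2 hx

lemma sq_integral_le {μ : Measure X} [IsProbabilityMeasure μ] {f : X → ℝ} (hf : MemLp f 2 μ) :
    (∫ x, f x ∂μ) ^ 2 ≤ ∫ x, f x ^ 2 ∂μ := by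
  have h := variance_nonneg f μ
  rw [variance_eq_sub hf] at h
  simpa using h

lemma memLp_integral_kernel (hrev : MeasurePreserving Prod.swap (π ⊗ₘ κ) (π ⊗ₘ κ))
    {f : X → ℝ} (hf : MemLp f 2 π) : MemLp (fun x => ∫ y, f y ∂(κ x)) 2 π := by
  have h1 := memLp_snd hrev hf
  have hm : AEStronglyMeasurable (fun x => ∫ y, f y ∂(κ x)) π :=
    ((h1.integrable one_le_two).integral_measure_compProd).aestronglyMeasurable
  rw [memLp_two_iff_integrable_sq hm]
  refine Integrable.mono' (h1.integrable_sq.integral_measure_compProd) (hm.pow 2) ?_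
  filter_upwards [ae_memLp_kernel hrev hf] with x hx
  rw [Real.norm_of_nonneg (sq_nonneg _)]
  exact sq_integral_le hx

lemma integral_mul_integral_kernel (hrev : MeasurePreserving Prod.swap (π ⊗ₘ κ) (π ⊗ₘ κ))
    {f g : X → ℝ} (hf : MemLp f 2 π) (hg : MemLp g 2 π) :
    ∫ x, g x * ∫ y, f y ∂(κ x) ∂π = ∫ p : X × X, g p.1 * f p.2 ∂(π ⊗ₘ κ) := by
  rw [Measure.integral_compProd (integrable_fst_mul_snd hrev hg hf)]
  simp_rw [integral_const_mul]

lemma integral_integral_kernel (hrev : MeasurePreserving Prod.swap (π ⊗ₘ κ) (π ⊗ₘ κ))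
    {f : X → ℝ} (hf : MemLp f 2 π) : ∫ x, ∫ y, f y ∂(κ x) ∂π = ∫ x, f x ∂π := by
  rw [← integral_snd_compProd hrev hf.aestronglyMeasurable,
    Measure.integral_compProd ((memLp_snd hrev hf).integrable one_le_two)]

omit [IsProbabilityMeasure π] [IsMarkovKernel κ] in
lemma integral_fst_mul_snd_comm (hrev : MeasurePreserving Prod.swap (π ⊗ₘ κ) (π ⊗ₘ κ))
    (f g : X → ℝ) :
    ∫ p : X × X, f p.1 * g p.2 ∂(π ⊗ₘ κ) = ∫ p : X × X, g p.1 * f p.2 ∂(π ⊗ₘ κ) := by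
  rw [← integral_comp_swap hrev]
  simp [mul_comm]

lemma integrable_sub_sq (hrev : MeasurePreserving Prod.swap (π ⊗ₘ κ) (π ⊗ₘ κ))
    {f : X → ℝ} (hf : MemLp f 2 π) :
    Integrable (fun p : X × X => (f p.1 - f p.2) ^ 2) (π ⊗ₘ κ) :=
  ((memLp_fst hf).sub (memLp_snd hrev hf)).integrable_sq

/-- The Dirichlet form of a reversible kernel. -/
lemma integral_sub_sq (hrev : MeasurePreserving Prod.swap (π ⊗ₘ κ) (π ⊗ₘ κ))
    {f : X → ℝ} (hf : MemLp f 2 π) :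
    ∫ p : X × X, (f p.1 - f p.2) ^ 2 ∂(π ⊗ₘ κ)
      = 2 * (∫ x, f x ^ 2 ∂π - ∫ p : X × X, f p.1 * f p.2 ∂(π ⊗ₘ κ)) := by
  have e : ∀ p : X × X, (f p.1 - f p.2) ^ 2
      = (f p.1 ^ 2 + f p.2 ^ 2) - 2 * (f p.1 * f p.2) := fun p => by ring
  have h1 := (memLp_fst (κ := κ) hf).integrable_sq
  have h2 := (memLp_snd hrev hf).integrable_sq
  have h3 := (integrable_fst_mul_snd hrev hf hf).const_mul 2
  have h12 : Integrable (fun p : X × X => f p.1 ^ 2 + f p.2 ^ 2) (π ⊗ₘ κ) := h1.add h2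
  simp_rw [e]
  rw [integral_sub h12 h3, integral_add h1 h2, integral_const_mul,
    integral_fst_compProd (f := fun x => f x ^ 2) hf.integrable_sq.aestronglyMeasurable,
    integral_snd_compProd hrev (f := fun x => f x ^ 2) hf.integrable_sq.aestronglyMeasurable]
  ring

variable {V : X → ℝ} {lam b α : ℝ} {K : Set X} {ν : Measure X} [IsProbabilityMeasure ν]

/-- The Lyapunov function estimate: `⟨f² / V, (I - P) V⟩ ≤ ⟨f, (I - P) f⟩`. -/
lemma integral_sq_le_of_drift (hrev : MeasurePreserving Prod.swap (π ⊗ₘ κ) (π ⊗ₘ κ))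
    (hV : Measurable V) (hV1 : ∀ x, 1 ≤ V x) (hint : ∀ x, Integrable V (κ x))
    (hlam : 0 ≤ lam) (hb : 0 ≤ b) (hK : MeasurableSet K)
    (hdrift : ∀ x, ∫ y, V y ∂(κ x) ≤ (1 - lam) * V x + b * K.indicator (fun _ => (1 : ℝ)) x)
    {f : X → ℝ} (hf : MemLp f 2 π) :
    lam * ∫ x, f x ^ 2 ∂π ≤ (∫ x, f x ^ 2 ∂π - ∫ p : X × X, f p.1 * f p.2 ∂(π ⊗ₘ κ))
      + b * ∫ x in K, f x ^ 2 ∂π := by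
  have hV0 : ∀ x, 0 < V x := fun x => zero_lt_one.trans_le (hV1 x)
  -- The integral of `G` is `⟨f² / V, P V⟩`, written on pairs so that reversibility can symmetrize
  -- it.
  set G : X × X → ℝ := fun p => f p.1 ^ 2 * (V p.2 / V p.1) with hG
  have hsq := hf.integrable_sq
  have hGm : AEStronglyMeasurable G (π ⊗ₘ κ) := by
    refine (memLp_fst (κ := κ) hf).integrable_sq.aestronglyMeasurable.mul ?_
    exact ((hV.comp measurable_snd).div (hV.comp measurable_fst)).aestronglyMeasurable
  have hGn : ∀ p, 0 ≤ G p := fun p =>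
    mul_nonneg (sq_nonneg _) (div_nonneg (hV0 _).le (hV0 _).le)
  have hinner : ∀ x, ∫ y, G (x, y) ∂(κ x) = f x ^ 2 * ((∫ y, V y ∂(κ x)) / V x) := fun x => by
    simp only [hG]
    rw [integral_const_mul, integral_div]
  have hind : ∀ x, K.indicator (fun _ => (1 : ℝ)) x ≤ 1 := fun x =>
    Set.indicator_le_self' (fun _ _ => zero_le_one) x
  have hind0 : ∀ x, 0 ≤ K.indicator (fun _ => (1 : ℝ)) x := fun x =>
    Set.indicator_nonneg (fun _ _ => zero_le_one) x
  have hratio : ∀ x, (∫ y, V y ∂(κ x)) / V x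
      ≤ (1 - lam) + b * K.indicator (fun _ => (1 : ℝ)) x := fun x => by
    rw [div_le_iff₀ (hV0 x), add_mul]
    refine (hdrift x).trans (add_le_add le_rfl ?_)
    exact le_mul_of_one_le_right (mul_nonneg hb (hind0 x)) (hV1 x)
  have hGint : Integrable G (π ⊗ₘ κ) := by
    rw [Measure.integrable_compProd_iff hGm]
    refine ⟨ae_of_all _ fun x => ((hint x).div_const (V x)).const_mul (f x ^ 2), ?_⟩
    simp_rw [Real.norm_of_nonneg (hGn _), hinner]
    refine Integrable.mono' (hsq.mul_const (1 + b)) ?_ (ae_of_all _ fun x => ?_)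
    · refine hsq.aestronglyMeasurable.mul ?_
      have : StronglyMeasurable fun x => ∫ y, V y ∂(κ x) :=
        hV.stronglyMeasurable.integral_kernel
      exact (this.measurable.div hV).aestronglyMeasurable
    · rw [Real.norm_of_nonneg (mul_nonneg (sq_nonneg _) (div_nonneg
        (integral_nonneg fun y => (hV0 y).le) (hV0 x).le))]
      refine mul_le_mul_of_nonneg_left ((hratio x).trans ?_) (sq_nonneg _)
      nlinarith [hind x, hind0 x]
  have hGswap : Integrable (fun p : X × X => G p.swap) (π ⊗ₘ κ) :=
    hrev.integrable_comp_of_integrable hGint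
  have hff := integrable_fst_mul_snd hrev hf hf
  -- Symmetrized AM-GM: `2 f(x) f(y) ≤ f(x)² V(y)/V(x) + f(y)² V(x)/V(y)`.
  have h1 : 2 * ∫ p : X × X, f p.1 * f p.2 ∂(π ⊗ₘ κ) ≤ 2 * ∫ p, G p ∂(π ⊗ₘ κ) := by
    have : ∫ p, (G p + G p.swap) ∂(π ⊗ₘ κ) = 2 * ∫ p, G p ∂(π ⊗ₘ κ) := by
      rw [integral_add hGint hGswap, integral_comp_swap hrev]; ring
    rw [← this, ← integral_const_mul]
    refine integral_mono (hff.const_mul 2) (hGint.add hGswap) fun p => ?_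
    have ha := hV0 p.1
    have hc := hV0 p.2
    simp only [hG, Prod.fst_swap, Prod.snd_swap]
    have : f p.1 ^ 2 * (V p.2 / V p.1) + f p.2 ^ 2 * (V p.1 / V p.2) - 2 * (f p.1 * f p.2)
        = (f p.1 * V p.2 - f p.2 * V p.1) ^ 2 / (V p.1 * V p.2) := by
      field_simp; ring
    have h0 : 0 ≤ (f p.1 * V p.2 - f p.2 * V p.1) ^ 2 / (V p.1 * V p.2) := by positivity
    linarith
  have h2 : ∫ p, G p ∂(π ⊗ₘ κ)
      ≤ (1 - lam) * ∫ x, f x ^ 2 ∂π + b * ∫ x in K, f x ^ 2 ∂π := by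
    rw [Measure.integral_compProd hGint, ← integral_indicator hK, ← integral_const_mul,
      ← integral_const_mul, ← integral_add (hsq.const_mul _) ((hsq.indicator hK).const_mul _)]
    refine integral_mono hGint.integral_measure_compProd
      ((hsq.const_mul _).add ((hsq.indicator hK).const_mul _)) fun x => ?_
    simp only
    rw [hinner]
    refine (mul_le_mul_of_nonneg_left (hratio x) (sq_nonneg _)).trans (le_of_eq ?_)
    by_cases hx : x ∈ K <;> simp [hx] <;> ring
  linarith

/-- The local Poincaré inequality on a small set. -/
lemma exists_integral_sub_const_sq_le (hrev : MeasurePreserving Prod.swap (π ⊗ₘ κ) (π ⊗ₘ κ))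
    (hK : MeasurableSet K) (hα : 0 < α)
    (hminor : ∀ A, MeasurableSet A → ∀ x ∈ K, α * ν.real A ≤ (κ x).real A)
    {f : X → ℝ} (hf : MemLp f 2 π) :
    ∃ c, α * ∫ x in K, (f x - c) ^ 2 ∂π ≤ ∫ p : X × X, (f p.1 - f p.2) ^ 2 ∂(π ⊗ₘ κ) := by
  have hle : ∀ x ∈ K, ENNReal.ofReal α • ν ≤ κ x := fun x hx => by
    refine Measure.le_iff.2 fun A hA => ?_
    have := ENNReal.ofReal_le_ofReal (hminor A hA x hx)
    rwa [ENNReal.ofReal_mul hα.le, ofReal_measureReal, ofReal_measureReal] at this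
  have hα' : ENNReal.ofReal α ≠ 0 := by simpa using hα
  -- The constant should be the `ν`-mean of `f`, so `f` must be square integrable for `ν`. Since `α
  -- ν ≤ κ x` on `K`, one point `x ∈ K` with `f ∈ L²(κ x)` suffices; if there is none, `K` is
  -- `π`-null.
  by_cases hne : ∃ x ∈ K, MemLp f 2 (κ x)
  · obtain ⟨x₀, hx₀, hfx₀⟩ := hne
    have hfν : MemLp f 2 ν := by
      have := (hfx₀.mono_measure (hle x₀ hx₀))
      have h2 := this.smul_measure (c := (ENNReal.ofReal α)⁻¹) (by simpa using hα)
      rwa [smul_smul, ENNReal.inv_mul_cancel hα' ENNReal.ofReal_ne_top, one_smul] at h2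
    refine ⟨∫ y, f y ∂ν, ?_⟩
    set c := ∫ y, f y ∂ν with hc
    have hD := integrable_sub_sq hrev hf
    have hDx := hD.integral_measure_compProd
    have hsub : MemLp (fun x => f x - c) 2 π := hf.sub (memLp_const c)
    rw [Measure.integral_compProd hD, ← integral_const_mul]
    refine le_trans ?_ (setIntegral_le_integral (s := K) hDx
      (ae_of_all _ fun x => integral_nonneg fun y => sq_nonneg _))
    refine integral_mono_ae (hsub.integrable_sq.integrableOn.const_mul α) hDx.integrableOn ?_
    rw [Filter.EventuallyLE, ae_restrict_iff' hK]
    filter_upwards [ae_memLp_kernel hrev hf] with x hx hxK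
    have e1 : (f x - c) ^ 2 ≤ ∫ y, (f x - f y) ^ 2 ∂ν := by
      have hsubν : MemLp (fun y => f x - f y) 2 ν := (memLp_const (f x)).sub hfν
      have := sq_integral_le hsubν
      rwa [integral_sub (integrable_const _) (hfν.integrable one_le_two), integral_const,
        probReal_univ, one_smul] at this
    have e2 := integral_mono_measure (hle x hxK) (f := fun y => (f x - f y) ^ 2)
      (ae_of_all _ fun y => sq_nonneg _)
      ((memLp_const (f x)).sub hx : MemLp (fun y => f x - f y) 2 (κ x)).integrable_sq
    rw [integral_smul_measure, ENNReal.toReal_ofReal hα.le, smul_eq_mul] at e2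
    exact (mul_le_mul_of_nonneg_left e1 hα.le).trans e2
  · refine ⟨0, ?_⟩
    push Not at hne
    have hK0 : π K = 0 := by
      refine measure_mono_null (fun x hx => ?_) (ae_iff.1 (ae_memLp_kernel hrev hf))
      exact hne x hx
    rw [Measure.restrict_eq_zero.2 hK0, integral_zero_measure, mul_zero]
    exact integral_nonneg fun p => sq_nonneg _

/-- The Poincaré inequality from drift and minorization conditions. -/
lemma poincare_of_drift_of_minorization
    (hrev : MeasurePreserving Prod.swap (π ⊗ₘ κ) (π ⊗ₘ κ))
    (hV : Measurable V) (hV1 : ∀ x, 1 ≤ V x) (hint : ∀ x, Integrable V (κ x))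
    (hlam : 0 ≤ lam) (hb : 0 ≤ b) (hα : 0 < α) (hK : MeasurableSet K)
    (hdrift : ∀ x, ∫ y, V y ∂(κ x) ≤ (1 - lam) * V x + b * K.indicator (fun _ => (1 : ℝ)) x)
    (hminor : ∀ A, MeasurableSet A → ∀ x ∈ K, α * ν.real A ≤ (κ x).real A)
    {f : X → ℝ} (hf : MemLp f 2 π) (hf0 : ∫ x, f x ∂π = 0) :
    lam * ∫ x, f x ^ 2 ∂π ≤
      (1 + 2 * b / α) * (∫ x, f x ^ 2 ∂π - ∫ p : X × X, f p.1 * f p.2 ∂(π ⊗ₘ κ)) := by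
  obtain ⟨c, hc⟩ := exists_integral_sub_const_sq_le hrev hK hα hminor hf
  have hg : MemLp (fun x => f x - c) 2 π := hf.sub (memLp_const c)
  have h1 := integral_sq_le_of_drift hrev hV hV1 hint hlam hb hK hdrift hg
  have h2 := integral_sub_sq hrev hg
  have h3 := integral_sub_sq hrev hf
  -- The Dirichlet form does not see the shift by `c`.
  simp only [sub_sub_sub_cancel_right] at h2
  have h4 : ∫ x, f x ^ 2 ∂π ≤ ∫ x, (f x - c) ^ 2 ∂π := by
    have e : ∀ x, (f x - c) ^ 2 = f x ^ 2 - 2 * c * f x + c ^ 2 := fun x => by ring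
    simp_rw [e]
    have i1 := (hf.integrable one_le_two).const_mul (2 * c)
    have i2 : Integrable (fun x => f x ^ 2 - 2 * c * f x) π := hf.integrable_sq.sub i1
    rw [integral_add i2 (integrable_const _),
      integral_sub hf.integrable_sq i1, integral_const_mul, hf0, integral_const]
    simp [sq_nonneg]
  set E := ∫ x, f x ^ 2 ∂π - ∫ p : X × X, f p.1 * f p.2 ∂(π ⊗ₘ κ) with hE
  have h5 : ∫ x in K, (f x - c) ^ 2 ∂π ≤ 2 * E / α := by
    rw [le_div_iff₀ hα]; linarith
  calc lam * ∫ x, f x ^ 2 ∂π ≤ lam * ∫ x, (f x - c) ^ 2 ∂π := by gcongr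
    _ ≤ E + b * ∫ x in K, (f x - c) ^ 2 ∂π := by linarith
    _ ≤ E + b * (2 * E / α) := by gcongr
    _ = _ := by ring

omit [IsProbabilityMeasure π] in
lemma eLpNorm_two_eq_ofReal_sqrt {f : X → ℝ} (hf : MemLp f 2 π) :
    eLpNorm f 2 π = ENNReal.ofReal (√(∫ x, f x ^ 2 ∂π)) := by
  rw [hf.eLpNorm_eq_integral_rpow_norm two_ne_zero ENNReal.ofNat_ne_top, Real.sqrt_eq_rpow]
  simp

/-- A reversible kernel with nonnegative quadratic form, bounded by `ρ` on mean zero functions,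
contracts `L²₀` by the factor `ρ`. -/
lemma eLpNorm_integral_kernel_le (hrev : MeasurePreserving Prod.swap (π ⊗ₘ κ) (π ⊗ₘ κ))
    (hpos : ∀ f : X → ℝ, MemLp f 2 π → 0 ≤ ∫ p : X × X, f p.1 * f p.2 ∂(π ⊗ₘ κ))
    {ρ : ℝ} (hρ : 0 < ρ)
    (hle : ∀ f : X → ℝ, MemLp f 2 π → ∫ x, f x ∂π = 0 →
      ∫ p : X × X, f p.1 * f p.2 ∂(π ⊗ₘ κ) ≤ ρ * ∫ x, f x ^ 2 ∂π)
    {f : X → ℝ} (hf : MemLp f 2 π) (hf0 : ∫ x, f x ∂π = 0) :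
    eLpNorm (fun x => ∫ y, f y ∂(κ x)) 2 π ≤ ENNReal.ofReal ρ * eLpNorm f 2 π := by
  set g : X → ℝ := fun x => ∫ y, f y ∂(κ x) with hgdef
  have hg : MemLp g 2 π := memLp_integral_kernel hrev hf
  have hg0 : ∫ x, g x ∂π = 0 := by rw [hgdef, integral_integral_kernel hrev hf, hf0]
  have hgf : ∫ p : X × X, g p.1 * f p.2 ∂(π ⊗ₘ κ) = ∫ x, g x ^ 2 ∂π := by
    rw [← integral_mul_integral_kernel hrev hf hg]
    simp_rw [sq]; rfl
  have hfg : ∫ p : X × X, f p.1 * g p.2 ∂(π ⊗ₘ κ) = ∫ x, g x ^ 2 ∂π := by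
    rw [integral_fst_mul_snd_comm hrev, hgf]
  -- Positivity at `f - ρ⁻¹ P f` reads `2 ρ⁻¹ ‖Pf‖² ≤ ⟨f, Pf⟩ + ρ⁻² ⟨Pf, P Pf⟩`. Since `f` and `Pf`
  -- both have mean zero, the right side is at most `ρ ‖f‖² + ρ⁻¹ ‖Pf‖²`.
  have h := hpos (fun x => f x - ρ⁻¹ * g x) (hf.sub (hg.const_mul ρ⁻¹))
  have e : ∀ p : X × X, (f p.1 - ρ⁻¹ * g p.1) * (f p.2 - ρ⁻¹ * g p.2)
      = (f p.1 * f p.2 + ρ⁻¹ ^ 2 * (g p.1 * g p.2))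
        - ρ⁻¹ * (f p.1 * g p.2 + g p.1 * f p.2) := fun p => by ring
  have iff := integrable_fst_mul_snd hrev hf hf
  have ifg := integrable_fst_mul_snd hrev hf hg
  have igf := integrable_fst_mul_snd hrev hg hf
  have igg := (integrable_fst_mul_snd hrev hg hg).const_mul (ρ⁻¹ ^ 2)
  simp_rw [e] at h
  have i1 : Integrable (fun p : X × X => f p.1 * f p.2 + ρ⁻¹ ^ 2 * (g p.1 * g p.2)) (π ⊗ₘ κ) :=
    iff.add igg
  have i2 : Integrable (fun p : X × X => f p.1 * g p.2 + g p.1 * f p.2) (π ⊗ₘ κ) := ifg.add igf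
  rw [integral_sub i1 (i2.const_mul _), integral_add iff igg,
    integral_const_mul, integral_const_mul, integral_add ifg igf, hfg, hgf] at h
  have hf' := hle f hf hf0
  have hg' := hle g hg hg0
  have key : ∫ x, g x ^ 2 ∂π ≤ ρ ^ 2 * ∫ x, f x ^ 2 ∂π := by
    have h6 : ρ⁻¹ ^ 2 * ∫ p : X × X, g p.1 * g p.2 ∂(π ⊗ₘ κ) ≤ ρ⁻¹ * ∫ x, g x ^ 2 ∂π := by
      calc _ ≤ ρ⁻¹ ^ 2 * (ρ * ∫ x, g x ^ 2 ∂π) := by gcongr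
        _ = _ := by field_simp
    have h7 : ρ⁻¹ * ∫ x, g x ^ 2 ∂π ≤ ρ * ∫ x, f x ^ 2 ∂π := by linarith
    rw [inv_mul_le_iff₀ hρ] at h7
    linarith
  rw [eLpNorm_two_eq_ofReal_sqrt hf, eLpNorm_two_eq_ofReal_sqrt hg, ← ENNReal.ofReal_mul hρ.le]
  refine ENNReal.ofReal_le_ofReal ?_
  rw [Real.sqrt_le_left (by positivity), mul_pow,
    Real.sq_sqrt (integral_nonneg fun x => sq_nonneg _)]
  exact key

/-- The spectral gap from drift and minorization conditions, for a reversible kernel with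
nonnegative quadratic form. -/
theorem eLpNorm_integral_kernel_le_of_drift_of_minorization
    (hrev : MeasurePreserving Prod.swap (π ⊗ₘ κ) (π ⊗ₘ κ))
    (hpos : ∀ f : X → ℝ, MemLp f 2 π → 0 ≤ ∫ p : X × X, f p.1 * f p.2 ∂(π ⊗ₘ κ))
    (hV : Measurable V) (hV1 : ∀ x, 1 ≤ V x) (hint : ∀ x, Integrable V (κ x))
    (hlam : 0 ≤ lam) (hlam1 : lam < 1) (hb : 0 ≤ b) (hα : 0 < α) (hK : MeasurableSet K)
    (hdrift : ∀ x, ∫ y, V y ∂(κ x) ≤ (1 - lam) * V x + b * K.indicator (fun _ => (1 : ℝ)) x)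
    (hminor : ∀ A, MeasurableSet A → ∀ x ∈ K, α * ν.real A ≤ (κ x).real A)
    {f : X → ℝ} (hf : MemLp f 2 π) (hf0 : ∫ x, f x ∂π = 0) :
    eLpNorm (fun x => ∫ y, f y ∂(κ x)) 2 π
      ≤ ENNReal.ofReal (1 - lam / (1 + 2 * b / α)) * eLpNorm f 2 π := by
  have hC : 1 ≤ 1 + 2 * b / α := le_add_of_nonneg_right (by positivity)
  have hC0 : 0 < 1 + 2 * b / α := zero_lt_one.trans_le hC
  refine eLpNorm_integral_kernel_le hrev hpos ?_ (fun f hf hf0 => ?_) hf hf0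
  · rw [sub_pos, div_lt_one hC0]; linarith
  · have := poincare_of_drift_of_minorization hrev hV hV1 hint hlam hb hα hK hdrift hminor hf hf0
    rw [mul_comm, ← div_le_iff₀' hC0] at this
    rw [sub_mul, one_mul, div_mul_eq_mul_div, mul_comm lam]
    linarith

end Reversible

open scoped RealInnerProductSpace

/-! ### Gaussian integrals and positive definiteness -/

section Gaussian

variable {E : Type*} [NormedAddCommGroup E] [InnerProductSpace ℝ E] [FiniteDimensional ℝ E]
  [MeasurableSpace E] [BorelSpace E]

lemma integrable_exp_neg_mul_norm_sq {a : ℝ} (ha : 0 < a) :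
    Integrable fun z : E => Real.exp (-a * ‖z‖ ^ 2) := by
  -- A non-integrable function has Bochner integral `0`, so the nonzero closed form proves
  -- integrability.
  refine Integrable.of_integral_ne_zero ?_
  rw [GaussianFourier.integral_rexp_neg_mul_sq_norm ha]
  have := Real.pi_pos
  positivity

omit [FiniteDimensional ℝ E] [MeasurableSpace E] [BorelSpace E] in
lemma neg_mul_norm_sq_sub_inner {a : ℝ} (ha : 0 < a) (c z : E) :
    -a * ‖z‖ ^ 2 - ⟪c, z⟫ = -a * ‖z + (2 * a)⁻¹ • c‖ ^ 2 + ‖c‖ ^ 2 / (4 * a) := by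
  rw [norm_add_sq_real, norm_smul, inner_smul_right, real_inner_comm, Real.norm_of_nonneg
    (by positivity)]
  field_simp
  ring

lemma integrable_exp_neg_mul_norm_sq_sub_inner {a : ℝ} (ha : 0 < a) (c : E) :
    Integrable fun z : E => Real.exp (-a * ‖z‖ ^ 2 - ⟪c, z⟫) := by
  simp_rw [neg_mul_norm_sq_sub_inner ha, Real.exp_add]
  exact ((integrable_exp_neg_mul_norm_sq ha).comp_add_right _).mul_const _

lemma integral_exp_neg_mul_norm_sq_sub_inner {a : ℝ} (ha : 0 < a) (c : E) :
    ∫ z : E, Real.exp (-a * ‖z‖ ^ 2 - ⟪c, z⟫)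
      = (Real.pi / a) ^ (Module.finrank ℝ E / 2 : ℝ) * Real.exp (‖c‖ ^ 2 / (4 * a)) := by
  simp_rw [neg_mul_norm_sq_sub_inner ha, Real.exp_add]
  rw [integral_mul_const, integral_add_right_eq_self (fun z : E => Real.exp (-a * ‖z‖ ^ 2)),
    GaussianFourier.integral_rexp_neg_mul_sq_norm ha]

/-- The Gaussian kernel is, up to a constant, the square of a Gaussian convolution kernel. -/
lemma integral_exp_mul_exp {a : ℝ} (ha : 0 < a) (x y : E) :
    ∫ w : E, Real.exp (-a * ‖x - w‖ ^ 2) * Real.exp (-a * ‖y - w‖ ^ 2)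
      = (Real.pi / (2 * a)) ^ (Module.finrank ℝ E / 2 : ℝ)
        * Real.exp (-(a / 2) * ‖x - y‖ ^ 2) := by
  have key : ∀ w : E, Real.exp (-a * ‖x - w‖ ^ 2) * Real.exp (-a * ‖y - w‖ ^ 2)
      = Real.exp (-(2 * a) * ‖w - (2⁻¹ : ℝ) • (x + y)‖ ^ 2)
        * Real.exp (-(a / 2) * ‖x - y‖ ^ 2) := fun w => by
    rw [← Real.exp_add, ← Real.exp_add]
    congr 1
    simp only [norm_sub_sq_real, norm_smul, inner_smul_right, norm_add_sq_real, inner_add_right,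
      mul_pow, real_inner_comm w, Real.norm_eq_abs, sq_abs]
    ring
  simp_rw [key]
  rw [integral_mul_const,
    integral_sub_right_eq_self (fun w : E => Real.exp (-(2 * a) * ‖w‖ ^ 2)),
    GaussianFourier.integral_rexp_neg_mul_sq_norm (by positivity)]

/-- The Gaussian kernel is positive definite. -/
lemma integral_prod_exp_nonneg {a : ℝ} (ha : 0 < a) {F : E → ℝ}
    (hFm : AEStronglyMeasurable F volume)
    (hF : Integrable (fun p : E × E => F p.1 * Real.exp (-a * ‖p.1 - p.2‖ ^ 2) * F p.2)
      (volume.prod volume)) :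
    0 ≤ ∫ p : E × E, F p.1 * Real.exp (-a * ‖p.1 - p.2‖ ^ 2) * F p.2 ∂(volume.prod volume) := by
  have ha2 : 0 < 2 * a := by positivity
  set C : ℝ := (Real.pi / (2 * (2 * a))) ^ (Module.finrank ℝ E / 2 : ℝ) with hC
  have hC0 : 0 < C := by have := Real.pi_pos; positivity
  -- The rate `2a` is chosen so that convolving `k` with itself gives back rate `a`.
  set k : E → E → ℝ := fun x w => Real.exp (-(2 * a) * ‖x - w‖ ^ 2) with hk
  have hkk : ∀ x y, ∫ w, k x w * k y w = C * Real.exp (-a * ‖x - y‖ ^ 2) := fun x y => by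
    rw [hk, hC, integral_exp_mul_exp ha2, mul_div_cancel_left₀ a two_ne_zero]
  have hkm : Continuous fun q : E × E => k q.1 q.2 := by fun_prop
  set H : (E × E) × E → ℝ := fun q => (F q.1.1 * F q.1.2) * (k q.1.1 q.2 * k q.1.2 q.2) with hH
  have hFF : AEStronglyMeasurable (fun p : E × E => F p.1 * F p.2) (volume.prod volume) :=
    (hFm.comp_fst).mul (hFm.comp_snd)
  have hHm : AEStronglyMeasurable H ((volume.prod volume).prod volume) := by
    refine (hFF.comp_fst).mul (Continuous.aestronglyMeasurable ?_)
    fun_prop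
  have hkint : ∀ x y, Integrable fun w => k x w * k y w := fun x y => by
    refine Integrable.of_integral_ne_zero ?_
    rw [hkk]; positivity
  have hHint : Integrable H ((volume.prod volume).prod volume) := by
    rw [integrable_prod_iff hHm]
    refine ⟨ae_of_all _ fun p => (hkint p.1 p.2).const_mul (F p.1 * F p.2), ?_⟩
    have : ∀ p : E × E, ∫ w, ‖H (p, w)‖
        = C * ‖F p.1 * Real.exp (-a * ‖p.1 - p.2‖ ^ 2) * F p.2‖ := fun p => by
      have h1 : ∀ w, ‖H (p, w)‖ = ‖F p.1 * F p.2‖ * (k p.1 w * k p.2 w) := fun w => by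
        simp only [hH]
        rw [norm_mul, Real.norm_of_nonneg (mul_nonneg (Real.exp_nonneg _) (Real.exp_nonneg _))]
      simp_rw [h1]
      rw [integral_const_mul, hkk, norm_mul, norm_mul, norm_mul,
        Real.norm_of_nonneg (Real.exp_nonneg _)]
      ring
    simp_rw [this]
    exact hF.norm.const_mul C
  have h2 : ∫ q, H q ∂((volume.prod volume).prod volume)
      = C * ∫ p : E × E, F p.1 * Real.exp (-a * ‖p.1 - p.2‖ ^ 2) * F p.2
          ∂(volume.prod volume) := by
    rw [integral_prod _ hHint, ← integral_const_mul]
    congr 1 with p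
    simp only [hH]
    rw [integral_const_mul, hkk]
    ring
  have h3 : 0 ≤ ∫ q, H q ∂((volume.prod volume).prod volume) := by
    -- With `w` integrated last, the inner integral is the square `(∫ F(x) k(x, w) dx)²`.
    rw [integral_prod_symm _ hHint]
    refine integral_nonneg fun w => ?_
    have : ∀ p : E × E, H (p, w) = (F p.1 * k p.1 w) * (F p.2 * k p.2 w) := fun p => by
      simp only [hH]; ring
    simp_rw [this]
    rw [integral_prod_mul (fun x => F x * k x w) (fun x => F x * k x w)]
    exact mul_self_nonneg _
  rw [h2] at h3
  exact nonneg_of_mul_nonneg_right h3 hC0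

/-- Comparison with `(1 + ‖z‖)^{-n}` for `n` above the dimension, using `e^u ≥ u^n / n!` at `u = a
(1 + ‖z‖)`. -/
lemma integrable_exp_neg_mul_norm {a : ℝ} (ha : 0 < a) :
    Integrable fun z : E => Real.exp (-a * ‖z‖) := by
  set n := Module.finrank ℝ E + 1 with hn
  have h1 : Integrable fun z : E => (1 + ‖z‖) ^ (-(n : ℝ)) :=
    integrable_one_add_norm (by rw [hn]; push_cast; linarith)
  refine (h1.const_mul (Real.exp a * (n.factorial / a ^ n))).mono'
    (Continuous.aestronglyMeasurable (by fun_prop)) (ae_of_all _ fun z => ?_)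
  have hz : 0 < 1 + ‖z‖ := by positivity
  rw [Real.norm_of_nonneg (Real.exp_nonneg _), Real.rpow_neg hz.le, Real.rpow_natCast]
  have h2 := Real.pow_div_factorial_le_exp (a * (1 + ‖z‖)) (by positivity) n
  have h3 : -a * ‖z‖ = a - a * (1 + ‖z‖) := by ring
  rw [h3, Real.exp_sub, div_eq_mul_inv, mul_assoc]
  refine mul_le_mul_of_nonneg_left ?_ (Real.exp_nonneg _)
  rw [mul_pow] at h2
  have := inv_anti₀ (by positivity) h2
  refine this.trans (le_of_eq ?_)
  field_simp

end Gaussian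

/-! ### Taylor bounds and linear growth -/

section Taylor

variable {U : EuclideanSpace ℝ (Fin d) → ℝ}

lemma differentiable_gradient (hU : ContDiff ℝ 2 U) : Differentiable ℝ (fun x => ∇ U x) := by
  have h : ContDiff ℝ 1 (fderiv ℝ U) := hU.fderiv_right (by norm_num)
  exact (InnerProductSpace.toDual ℝ (EuclideanSpace ℝ (Fin d))).symm.differentiable.comp
    (h.differentiable one_ne_zero)

lemma norm_hessian_le (hHess : BddAbove (Set.range fun x => ‖hessian U x‖))
    (x : EuclideanSpace ℝ (Fin d)) : ‖hessian U x‖ ≤ hessSup U :=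
  le_ciSup hHess x

lemma norm_gradient_sub_le (hU : ContDiff ℝ 2 U)
    (hHess : BddAbove (Set.range fun x => ‖hessian U x‖)) (x y : EuclideanSpace ℝ (Fin d)) :
    ‖∇ U y - ∇ U x‖ ≤ hessSup U * ‖y - x‖ :=
  Convex.norm_image_sub_le_of_norm_fderiv_le (𝕜 := ℝ) (s := Set.univ)
    (fun z _ => differentiable_gradient hU z) (fun z _ => norm_hessian_le hHess z) convex_univ
    (Set.mem_univ x) (Set.mem_univ y)

lemma hasDerivAt_comp_line (hU : ContDiff ℝ 2 U) (x z : EuclideanSpace ℝ (Fin d)) (t : ℝ) :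
    HasDerivAt (fun s : ℝ => U (x + s • z)) ⟪∇ U (x + t • z), z⟫ t := by
  have h1 : HasDerivAt (fun s : ℝ => x + s • z) z t := by
    simpa using ((hasDerivAt_id t).smul_const z).const_add x
  have h2 := ((hU.differentiable two_ne_zero) (x + t • z)).hasGradientAt.hasFDerivAt
  exact (h2.comp_hasDerivAt t h1).congr_deriv (InnerProductSpace.toDual_apply_apply ..)

/-- Along the segment the remainder has derivative at most `m t ‖z‖²` in absolute value, by the
Lipschitz bound on the gradient; it is compared with the primitive `m t² ‖z‖² / 2`. -/
lemma abs_taylor_remainder_le (hU : ContDiff ℝ 2 U)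
    (hHess : BddAbove (Set.range fun x => ‖hessian U x‖)) (x z : EuclideanSpace ℝ (Fin d)) :
    |U (x + z) - U x - ⟪∇ U x, z⟫| ≤ hessSup U / 2 * ‖z‖ ^ 2 := by
  set m := hessSup U
  have hinner : ∀ t : ℝ, 0 ≤ t →
      |⟪∇ U (x + t • z), z⟫ - ⟪∇ U x, z⟫| ≤ m * t * ‖z‖ ^ 2 := fun t ht => by
    rw [← inner_sub_left]
    refine (abs_real_inner_le_norm _ _).trans ?_
    have := norm_gradient_sub_le hU hHess x (x + t • z)
    rw [add_sub_cancel_left, norm_smul, Real.norm_of_nonneg ht] at this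
    calc _ ≤ m * (t * ‖z‖) * ‖z‖ := mul_le_mul_of_nonneg_right this (norm_nonneg _)
      _ = _ := by ring
  have hφ : ∀ t : ℝ, HasDerivAt (fun s : ℝ => U (x + s • z) - s * ⟪∇ U x, z⟫)
      (⟪∇ U (x + t • z), z⟫ - ⟪∇ U x, z⟫) t := fun t => by
    have := (hasDerivAt_comp_line hU x z t).sub ((hasDerivAt_id t).mul_const ⟪∇ U x, z⟫)
    rwa [one_mul] at this
  have hB : ∀ t : ℝ, HasDerivAt (fun s : ℝ => m / 2 * ‖z‖ ^ 2 * s ^ 2) (m * t * ‖z‖ ^ 2) t :=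
    fun t => ((hasDerivAt_pow 2 t).const_mul (m / 2 * ‖z‖ ^ 2)).congr_deriv (by
      push_cast; ring)
  have := image_norm_le_of_norm_deriv_right_le_deriv_boundary'
    (f := fun s : ℝ => U (x + s • z) - s * ⟪∇ U x, z⟫ - U x)
    (f' := fun t => ⟪∇ U (x + t • z), z⟫ - ⟪∇ U x, z⟫) (a := 0) (b := 1)
    (B := fun s : ℝ => m / 2 * ‖z‖ ^ 2 * s ^ 2) (B' := fun t => m * t * ‖z‖ ^ 2)
    (fun t _ => ((hφ t).sub_const _).continuousAt.continuousWithinAt)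
    (fun t _ => ((hφ t).sub_const _).hasDerivWithinAt) (by simp)
    (fun t _ => (hB t).continuousAt.continuousWithinAt)
    (fun t _ => (hB t).hasDerivWithinAt)
    (fun t ht => by rw [Real.norm_eq_abs]; exact hinner t ht.1)
    (Set.right_mem_Icc.2 zero_le_one)
  rw [Real.norm_eq_abs] at this
  have e : U (x + z) - U x - ⟪∇ U x, z⟫ = U (x + (1 : ℝ) • z) - 1 * ⟪∇ U x, z⟫ - U x := by
    rw [one_smul]; ring
  rw [e]
  linarith

/-- A function bounded below by `1` whose gradient has norm larger than `c` outside of a ball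
grows at least linearly. -/
lemma one_add_mul_le_of_lt_norm_gradient (hU : ContDiff ℝ 2 U) (hbelow : ∀ x, 1 ≤ U x)
    {c R : ℝ} (hc : 0 < c) (hgrad : ∀ x, R ≤ ‖x‖ → c < ‖∇ U x‖)
    (x : EuclideanSpace ℝ (Fin d)) : 1 + c * (‖x‖ - R) ≤ U x := by
  have hcont : Continuous fun y => U y + c * ‖y - x‖ := by
    have := hU.continuous
    fun_prop
  have hlim : Filter.Tendsto (fun y => U y + c * ‖y - x‖) (Filter.cocompact _) Filter.atTop := by
    have h1 : Filter.Tendsto (fun y : EuclideanSpace ℝ (Fin d) => 1 + c * (‖y‖ - ‖x‖))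
        (Filter.cocompact _) Filter.atTop := by
      refine Filter.tendsto_atTop_add_const_left _ _ (Filter.Tendsto.const_mul_atTop hc ?_)
      exact Filter.tendsto_atTop_add_const_right _ _ tendsto_norm_cocompact_atTop
    refine Filter.tendsto_atTop_mono (fun y => ?_) h1
    gcongr
    · exact hbelow y
    · exact norm_sub_norm_le y x
  -- Minimize the penalized function `U + c ‖· - x‖`. At the minimizer `y` the gradient has norm at
  -- most `c`, since otherwise a small step along `-∇U(y)` lowers the value. So `‖y‖ < R`, and
  -- comparing the values at `x` and `y` gives the growth.
  obtain ⟨y, hy⟩ := hcont.exists_forall_le hlim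
  have hyg : ‖∇ U y‖ ≤ c := by
    by_contra hlt
    rw [not_le] at hlt
    set g := ∇ U y with hg
    have hmin : ∀ t : ℝ, 0 ≤ t → 0 ≤ U (y + t • (-g)) - U y + c * (t * ‖g‖) := fun t ht => by
      have h1 := hy (y + t • (-g))
      have h2 : ‖y + t • (-g) - x‖ ≤ ‖y - x‖ + t * ‖g‖ := by
        have : y + t • (-g) - x = (y - x) + t • (-g) := by abel
        rw [this]
        refine (norm_add_le _ _).trans ?_
        rw [norm_smul, norm_neg, Real.norm_of_nonneg ht]
      have := mul_le_mul_of_nonneg_left h2 hc.le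
      linarith
    have hder : HasDerivAt (fun t : ℝ => U (y + t • (-g)) - U y + c * (t * ‖g‖))
        (-‖g‖ ^ 2 + c * ‖g‖) 0 := by
      have h := ((hasDerivAt_comp_line hU y (-g) 0).sub_const (U y)).add
        (((hasDerivAt_id (0 : ℝ)).mul_const ‖g‖).const_mul c)
      simp only [zero_smul, add_zero, inner_neg_right, one_mul] at h
      rwa [← hg, real_inner_self_eq_norm_sq] at h
    have hneg : -‖g‖ ^ 2 + c * ‖g‖ < 0 := by nlinarith [hc.trans hlt]
    have hlt0 := hder.hasDerivWithinAt (s := Set.Ici 0) |>.Ioi_of_Ici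
    have hev := (hasDerivWithinAt_iff_tendsto_slope' (by simp)).1 hlt0
    have hev2 := (hev.eventually (gt_mem_nhds hneg)).and self_mem_nhdsWithin
    obtain ⟨t, ht, ht0⟩ := hev2.exists
    have ht0 : 0 < t := ht0
    simp only [slope_def_field, zero_smul, add_zero, sub_self, zero_mul, mul_zero, sub_zero] at ht
    have := div_nonneg (hmin t ht0.le) ht0.le
    linarith
  have hyR : ‖y‖ < R := by
    by_contra h
    exact absurd (hgrad y (not_lt.1 h)) (not_lt.2 hyg)
  have h1 := hy x
  simp only [sub_self, norm_zero, mul_zero, add_zero] at h1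
  have h2 : ‖x‖ - R ≤ ‖y - x‖ := by
    have := norm_sub_norm_le x y
    rw [norm_sub_rev] at this
    linarith
  have := mul_le_mul_of_nonneg_left h2 hc.le
  linarith [hbelow y]

end Taylor

/-! ### The weight, the drift condition and the minorization condition -/

section Weight

open ProbabilityTheory
open scoped RealInnerProductSpace

variable {U : EuclideanSpace ℝ (Fin d) → ℝ} {ε : ℝ}

lemma gaussKernel_eq (ε : ℝ) (z : EuclideanSpace ℝ (Fin d)) :
    gaussKernel ε z = Real.exp (-(1 / (4 * ε)) * ‖z‖ ^ 2) := by
  rw [gaussKernel]; congr 1; ring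

lemma weight_pos (x y : EuclideanSpace ℝ (Fin d)) : 0 < weight U ε x y :=
  mul_pos (Real.exp_pos _) (Real.exp_pos _)

lemma continuous_weight (hU : Continuous U) :
    Continuous fun p : EuclideanSpace ℝ (Fin d) × EuclideanSpace ℝ (Fin d) =>
      weight U ε p.1 p.2 := by
  unfold weight gaussKernel
  fun_prop

lemma continuous_weight_right (hU : Continuous U) (x : EuclideanSpace ℝ (Fin d)) :
    Continuous fun y => weight U ε x y := by
  unfold weight gaussKernel
  fun_prop

lemma integrable_gaussKernel_sub (hε : 0 < ε) (x : EuclideanSpace ℝ (Fin d)) :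
    Integrable fun y => gaussKernel ε (x - y) := by
  have h : Integrable fun z : EuclideanSpace ℝ (Fin d) => gaussKernel ε z := by
    simp_rw [gaussKernel_eq]
    exact integrable_exp_neg_mul_norm_sq (by positivity)
  exact h.comp_sub_left x

lemma integral_gaussKernel_sub (hε : 0 < ε) (x : EuclideanSpace ℝ (Fin d)) :
    ∫ y, gaussKernel ε (x - y) = (Real.pi / (1 / (4 * ε))) ^ (d / 2 : ℝ) := by
  rw [integral_sub_left_eq_self (fun y => gaussKernel ε y) volume x]
  simp_rw [gaussKernel_eq]
  rw [GaussianFourier.integral_rexp_neg_mul_sq_norm (by positivity), finrank_euclideanSpace_fin]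

lemma weight_le_gaussKernel (hbelow : ∀ x, 1 ≤ U x) (x y : EuclideanSpace ℝ (Fin d)) :
    weight U ε x y ≤ gaussKernel ε (x - y) :=
  mul_le_of_le_one_right (Real.exp_nonneg _)
    (Real.exp_le_one_iff.2 (by linarith [hbelow y]))

lemma integrable_weight (hU : Continuous U) (hbelow : ∀ x, 1 ≤ U x) (hε : 0 < ε)
    (x : EuclideanSpace ℝ (Fin d)) : Integrable fun y => weight U ε x y :=
  (integrable_gaussKernel_sub hε x).mono' (continuous_weight_right hU x).aestronglyMeasurable
    (ae_of_all _ fun y => by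
      rw [Real.norm_of_nonneg (weight_pos x y).le]; exact weight_le_gaussKernel hbelow x y)

lemma integrable_weight_mul (hU : Continuous U) (hbelow : ∀ x, 1 ≤ U x) (hε : 0 < ε)
    (x : EuclideanSpace ℝ (Fin d)) : Integrable fun y => weight U ε x y * U y :=
  (integrable_gaussKernel_sub hε x).mono'
    ((continuous_weight_right hU x).mul hU).aestronglyMeasurable
    (ae_of_all _ fun y => by
      have hUy : 0 ≤ U y := by linarith [hbelow y]
      rw [Real.norm_of_nonneg (mul_nonneg (weight_pos x y).le hUy), weight, mul_assoc]
      refine mul_le_of_le_one_right (Real.exp_nonneg _) ?_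
      rw [Real.exp_neg, inv_mul_le_iff₀ (Real.exp_pos _), mul_one]
      linarith [Real.add_one_le_exp (U y)])

lemma integral_weight_pos (hU : Continuous U) (hbelow : ∀ x, 1 ≤ U x) (hε : 0 < ε)
    (x : EuclideanSpace ℝ (Fin d)) : 0 < ∫ y, weight U ε x y := by
  rw [integral_pos_iff_support_of_nonneg (fun y => (weight_pos x y).le)
    (integrable_weight hU hbelow hε x)]
  have : Function.support (fun y => weight U ε x y) = Set.univ :=
    Set.eq_univ_of_forall fun y => (weight_pos x y).ne'
  rw [this]
  exact Measure.measure_univ_pos.2 (NeZero.ne _)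

/-- As `1 / 0 = 0`, the upper bound on `ε` already excludes `m = 0`. -/
lemma hessSup_pos (hε : 0 < ε) (hε' : ε < 1 / (4 * hessSup U)) : 0 < hessSup U := by
  have := one_div_pos.1 (hε.trans hε')
  linarith

lemma mul_hessSup_lt (hε : 0 < ε) (hε' : ε < 1 / (4 * hessSup U)) : 4 * hessSup U * ε < 1 := by
  have := hessSup_pos hε hε'
  rwa [lt_div_iff₀ (by positivity), mul_comm] at hε'

lemma one_le_dim (hε : 0 < ε) (hε' : ε < 1 / (4 * hessSup U)) : 1 ≤ d := by
  by_contra h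
  obtain rfl : d = 0 := by omega
  have h0 : hessSup U = 0 := by
    have : ∀ x, hessian U x = 0 := fun x => Subsingleton.elim _ _
    simp [hessSup, this]
  exact (hessSup_pos hε hε').ne' h0

lemma weight_add_eq (x z : EuclideanSpace ℝ (Fin d)) :
    weight U ε x (x + z) = Real.exp (-(1 / (4 * ε)) * ‖z‖ ^ 2 - U (x + z)) := by
  rw [weight, gaussKernel_eq, ← Real.exp_add, sub_add_cancel_left, norm_neg, sub_eq_add_neg]

lemma integral_weight_add (x : EuclideanSpace ℝ (Fin d)) :
    ∫ z, weight U ε x (x + z) = ∫ y, weight U ε x y :=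
  integral_add_left_eq_self (fun y => weight U ε x y) x

lemma le_weight_add (hU : ContDiff ℝ 2 U)
    (hHess : BddAbove (Set.range fun x => ‖hessian U x‖)) (x z : EuclideanSpace ℝ (Fin d)) :
    Real.exp (-U x) * Real.exp (-(1 / (4 * ε) + hessSup U / 2) * ‖z‖ ^ 2 - ⟪∇ U x, z⟫)
      ≤ weight U ε x (x + z) := by
  rw [weight_add_eq, ← Real.exp_add, Real.exp_le_exp]
  have := (abs_le.1 (abs_taylor_remainder_le hU hHess x z)).2
  linarith

lemma weight_add_le (hU : ContDiff ℝ 2 U)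
    (hHess : BddAbove (Set.range fun x => ‖hessian U x‖)) (x z : EuclideanSpace ℝ (Fin d)) :
    weight U ε x (x + z) ≤
      Real.exp (-U x) * Real.exp (-(1 / (4 * ε) - hessSup U / 2) * ‖z‖ ^ 2 - ⟪∇ U x, z⟫) := by
  rw [weight_add_eq, ← Real.exp_add, Real.exp_le_exp]
  have := (abs_le.1 (abs_taylor_remainder_le hU hHess x z)).1
  linarith

/-- Taylor's upper bound on `U` leaves a Gaussian of rate `1/(4ε) + m/2` tilted by `∇U(x)`, which is
integrated by completing the square. -/
lemma le_integral_weight (hU : ContDiff ℝ 2 U) (hbelow : ∀ x, 1 ≤ U x)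
    (hHess : BddAbove (Set.range fun x => ‖hessian U x‖)) (hε : 0 < ε) (hm : 0 < hessSup U)
    (x : EuclideanSpace ℝ (Fin d)) :
    Real.exp (-U x) * ((Real.pi / (1 / (4 * ε) + hessSup U / 2)) ^ (d / 2 : ℝ)
      * Real.exp (‖∇ U x‖ ^ 2 / (4 * (1 / (4 * ε) + hessSup U / 2)))) ≤
      ∫ y, weight U ε x y := by
  have ha : 0 < 1 / (4 * ε) + hessSup U / 2 := by positivity
  have h := integral_exp_neg_mul_norm_sq_sub_inner ha (∇ U x)
  rw [finrank_euclideanSpace_fin] at h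
  rw [← h, ← integral_const_mul, ← integral_weight_add]
  exact integral_mono ((integrable_exp_neg_mul_norm_sq_sub_inner ha _).const_mul _)
    ((integrable_weight hU.continuous hbelow hε x).comp_add_left x)
    fun z => le_weight_add hU hHess x z

lemma integral_weight_le (hU : ContDiff ℝ 2 U) (hbelow : ∀ x, 1 ≤ U x)
    (hHess : BddAbove (Set.range fun x => ‖hessian U x‖)) (hε : 0 < ε)
    (ha : 0 < 1 / (4 * ε) - hessSup U / 2) (x : EuclideanSpace ℝ (Fin d)) :
    ∫ y, weight U ε x y ≤
      Real.exp (-U x) * ((Real.pi / (1 / (4 * ε) - hessSup U / 2)) ^ (d / 2 : ℝ)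
        * Real.exp (‖∇ U x‖ ^ 2 / (4 * (1 / (4 * ε) - hessSup U / 2)))) := by
  have h := integral_exp_neg_mul_norm_sq_sub_inner ha (∇ U x)
  rw [finrank_euclideanSpace_fin] at h
  rw [← h, ← integral_const_mul, ← integral_weight_add]
  exact integral_mono ((integrable_weight hU.continuous hbelow hε x).comp_add_left x)
    ((integrable_exp_neg_mul_norm_sq_sub_inner ha _).const_mul _)
    fun z => weight_add_le hU hHess x z

lemma rpow_half_le_exp {r t : ℝ} (hr : 0 ≤ r) (h : r ≤ Real.exp t) (d : ℕ) :
    r ^ (d / 2 : ℝ) ≤ Real.exp (t * (d / 2)) := by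
  rw [Real.exp_mul]
  exact Real.rpow_le_rpow hr h (by positivity)

/-- Jensen's inequality for the transition probability: a bound of `T_ε U` in terms of
`∫ g_ε / ∫ g_ε e^{-U}`. -/
lemma diffusionMap_le_of_integral_le (hU : Continuous U) (hbelow : ∀ x, 1 ≤ U x) (hε : 0 < ε)
    (x : EuclideanSpace ℝ (Fin d)) {s : ℝ}
    (hs : ∫ y, gaussKernel ε (x - y) ≤ Real.exp s * ∫ y, weight U ε x y) :
    diffusionMap U ε U x ≤ s := by
  have hZ := integral_weight_pos hU hbelow hε x
  have hw := integrable_weight hU hbelow hε x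
  have hwU := integrable_weight_mul hU hbelow hε x
  rw [diffusionMap, div_le_iff₀ hZ]
  have hi : Integrable fun y => (1 - s) * weight U ε x y + weight U ε x y * U y :=
    (hw.const_mul _).add hwU
  -- The tangent line `1 + (U - s) ≤ e^{U - s}`, integrated against the weight: the factor `e^U`
  -- turns the weight back into `g_ε`.
  have h1 : ∫ y, ((1 - s) * weight U ε x y + weight U ε x y * U y)
      ≤ ∫ y, Real.exp (-s) * gaussKernel ε (x - y) := by
    refine integral_mono hi ((integrable_gaussKernel_sub hε x).const_mul _) fun y => ?_
    have h2 := Real.add_one_le_exp (U y - s)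
    have h3 : Real.exp (-s) * gaussKernel ε (x - y)
        = weight U ε x y * Real.exp (U y - s) := by
      rw [weight, mul_assoc, ← Real.exp_add, mul_comm]
      congr 2; ring
    simp only
    rw [h3]
    have := mul_le_mul_of_nonneg_left h2 (weight_pos (U := U) (ε := ε) x y).le
    linarith
  rw [integral_add (hw.const_mul _) hwU, integral_const_mul, integral_const_mul] at h1
  have h4 : Real.exp (-s) * ∫ y, gaussKernel ε (x - y) ≤ ∫ y, weight U ε x y := by
    rw [Real.exp_neg, inv_mul_le_iff₀ (Real.exp_pos _)]; exact hs
  linarith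

/-- The ratio of Gaussian constants, `(1 + 2mε)^{d/2} ≤ e^{ε d m}`, gives the term `d m`; completing
the square gives the gradient term. -/
lemma diffusionMap_le (hU : ContDiff ℝ 2 U) (hbelow : ∀ x, 1 ≤ U x)
    (hHess : BddAbove (Set.range fun x => ‖hessian U x‖)) (hε : 0 < ε)
    (hε' : ε < 1 / (4 * hessSup U)) (x : EuclideanSpace ℝ (Fin d)) :
    diffusionMap U ε U x ≤ U x + ε * (d * hessSup U - 1 / 2 * ‖∇ U x‖ ^ 2) := by
  refine diffusionMap_le_of_integral_le hU.continuous hbelow hε x ?_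
  have hm := hessSup_pos hε hε'
  have hmε := mul_hessSup_lt hε hε'
  have hZ := le_integral_weight hU hbelow hHess hε hm x
  rw [integral_gaussKernel_sub hε]
  set m := hessSup U
  set G := ‖∇ U x‖
  set B := 1 / (4 * ε) + m / 2 with hB
  have hBpos : 0 < B := by positivity
  have hpi := Real.pi_pos
  refine le_trans ?_ (mul_le_mul_of_nonneg_left hZ (Real.exp_nonneg _))
  have e1 : Real.pi / (1 / (4 * ε)) = (1 + 2 * m * ε) * (Real.pi / B) := by
    rw [hB]; field_simp; ring
  rw [e1, Real.mul_rpow (by positivity) (by positivity)]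
  have e2 : (1 + 2 * m * ε) ^ (d / 2 : ℝ) ≤ Real.exp (2 * m * ε * (d / 2)) :=
    rpow_half_le_exp (by positivity) (by linarith [Real.add_one_le_exp (2 * m * ε)]) d
  -- The exact coefficient is `ε / (1 + 2mε)`, and `2mε ≤ 1`.
  have e3 : ε / 2 * G ^ 2 ≤ G ^ 2 / (4 * B) := by
    have : 4 * B = (1 + 2 * m * ε) / ε := by rw [hB]; field_simp; ring
    rw [this, div_div_eq_mul_div, le_div_iff₀ (by positivity)]
    have : 0 ≤ G ^ 2 * ε := by positivity
    nlinarith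
  calc (1 + 2 * m * ε) ^ (d / 2 : ℝ) * (Real.pi / B) ^ (d / 2 : ℝ)
      ≤ Real.exp (2 * m * ε * (d / 2)) * (Real.pi / B) ^ (d / 2 : ℝ) := by gcongr
    _ ≤ Real.exp (ε * (d * m - 1 / 2 * G ^ 2) + G ^ 2 / (4 * B))
        * (Real.pi / B) ^ (d / 2 : ℝ) := by
      gcongr
      linarith
    _ = _ := by
      rw [Real.exp_add, Real.exp_add, Real.exp_neg]
      field_simp

lemma continuous_gradient (hU : ContDiff ℝ 2 U) : Continuous fun x => ∇ U x :=
  (differentiable_gradient hU).continuous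

lemma le_bZero (hU : ContDiff ℝ 2 U) {lam0 R : ℝ} {x : EuclideanSpace ℝ (Fin d)}
    (hx : x ∈ Metric.closedBall 0 R) :
    d * hessSup U + (lam0 * U x - 1 / 2 * ‖∇ U x‖ ^ 2) ≤ bZero U lam0 R := by
  have := hU.continuous
  have := continuous_gradient hU
  refine add_le_add le_rfl (le_csSup ?_ (Set.mem_image_of_mem _ hx))
  exact ((isCompact_closedBall _ _).image (by fun_prop)).bddAbove

lemma alphaMin_spec (hU : ContDiff ℝ 2 U) {R : ℝ} (hR : 0 < R) :
    0 < alphaMin U ε R ∧ ∀ x ∈ Metric.closedBall (0 : EuclideanSpace ℝ (Fin d)) R,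
      alphaMin U ε R ≤ (1 / √2) ^ d * Real.exp (-2 * ε * ‖∇ U x‖ ^ 2 - 3 * ε * (d * hessSup U)
        - 2 / sigmaSq U ε * ‖x - sigmaSq U ε • ∇ U x‖ ^ 2) := by
  have := continuous_gradient hU
  have hcomp : IsCompact ((fun x : EuclideanSpace ℝ (Fin d) =>
      (1 / √2) ^ d * Real.exp (-2 * ε * ‖∇ U x‖ ^ 2 - 3 * ε * (d * hessSup U)
        - 2 / sigmaSq U ε * ‖x - sigmaSq U ε • ∇ U x‖ ^ 2)) '' Metric.closedBall 0 R) :=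
    (isCompact_closedBall _ _).image (by fun_prop)
  refine ⟨?_, fun x hx => csInf_le hcomp.bddBelow (Set.mem_image_of_mem _ hx)⟩
  obtain ⟨x, -, hx⟩ := hcomp.sInf_mem
    ((Metric.nonempty_closedBall.2 hR.le).image _)
  rw [alphaMin, ← hx]
  positivity

/-- The centered Gaussian probability measure with variance `σ² / 2`. -/
def gaussMeasure (d : ℕ) (s : ℝ) : Measure (EuclideanSpace ℝ (Fin d)) :=
  volume.withDensity fun y => ENNReal.ofReal
    (((Real.pi / (1 / s)) ^ (d / 2 : ℝ))⁻¹ * Real.exp (-(1 / s) * ‖y‖ ^ 2))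

lemma integrable_gaussMeasure_density {s : ℝ} (hs : 0 < s) :
    Integrable fun y : EuclideanSpace ℝ (Fin d) =>
      ((Real.pi / (1 / s)) ^ (d / 2 : ℝ))⁻¹ * Real.exp (-(1 / s) * ‖y‖ ^ 2) :=
  (integrable_exp_neg_mul_norm_sq (by positivity)).const_mul _

lemma gaussMeasure_real {s : ℝ} (hs : 0 < s) {A : Set (EuclideanSpace ℝ (Fin d))}
    (hA : MeasurableSet A) :
    (gaussMeasure d s).real A = ∫ y in A,
      ((Real.pi / (1 / s)) ^ (d / 2 : ℝ))⁻¹ * Real.exp (-(1 / s) * ‖y‖ ^ 2) := by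
  have hpi := Real.pi_pos
  rw [Measure.real, gaussMeasure, withDensity_apply _ hA, integral_eq_lintegral_of_nonneg_ae
    (ae_of_all _ fun y => by positivity)
    (integrable_gaussMeasure_density hs).integrableOn.aestronglyMeasurable]

lemma isProbabilityMeasure_gaussMeasure {s : ℝ} (hs : 0 < s) :
    IsProbabilityMeasure (gaussMeasure d s) := by
  have hpi := Real.pi_pos
  refine ⟨?_⟩
  rw [gaussMeasure, withDensity_apply _ MeasurableSet.univ, setLIntegral_univ,
    ← ofReal_integral_eq_lintegral_ofReal (integrable_gaussMeasure_density hs)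
      (ae_of_all _ fun y => by positivity), integral_const_mul,
    GaussianFourier.integral_rexp_neg_mul_sq_norm (by positivity), finrank_euclideanSpace_fin,
    inv_mul_cancel₀ (by positivity), ENNReal.ofReal_one]

/-- Used at `t = 2mε`, to bound the ratio of the Gaussian constants in the minorization; it is the
source of the term `3 ε d m` in `α`. -/
lemma one_add_le_one_sub_mul_exp {t : ℝ} (ht : 0 ≤ t) (ht' : t ≤ 1 / 2) :
    1 + t ≤ (1 - t) * Real.exp (3 * t) := by
  have h := Real.quadratic_le_exp_of_nonneg (x := 3 * t) (by positivity)
  have h2 := mul_le_mul_of_nonneg_left h (by linarith : 0 ≤ 1 - t)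
  nlinarith [mul_nonneg ht ht, mul_nonneg (mul_nonneg ht ht) (by linarith : 0 ≤ 1 / 2 - t),
    mul_nonneg ht (by linarith : 0 ≤ 1 / 2 - t)]

lemma one_div_sqrt_two_pow (d : ℕ) : (1 / √2) ^ d = (1 / 2 : ℝ) ^ (d / 2 : ℝ) := by
  rw [show 1 / √2 = √(1 / 2 : ℝ) by rw [Real.sqrt_div zero_le_one, Real.sqrt_one],
    Real.sqrt_eq_rpow, ← Real.rpow_natCast,
    ← Real.rpow_mul (by norm_num), one_div_mul_eq_div]

/-- Pointwise minorization of the transition density. The numerator is bounded below by a Gaussian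
centered at `p = x - σ²∇U(x)`, the normalization above by a Gaussian integral of rate `C = 1/(4ε) -
m/2`. The minorizing density may not depend on `x`, so the center is moved to the origin. -/
lemma alphaMin_mul_le_weight (hU : ContDiff ℝ 2 U) (hbelow : ∀ x, 1 ≤ U x)
    (hHess : BddAbove (Set.range fun x => ‖hessian U x‖)) (hε : 0 < ε)
    (hε' : ε < 1 / (4 * hessSup U)) {R : ℝ} (hR : 0 < R)
    {x : EuclideanSpace ℝ (Fin d)} (hx : x ∈ Metric.closedBall 0 R)
    (y : EuclideanSpace ℝ (Fin d)) :
    alphaMin U ε R * (((Real.pi / (1 / sigmaSq U ε)) ^ (d / 2 : ℝ))⁻¹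
      * Real.exp (-(1 / sigmaSq U ε) * ‖y‖ ^ 2)) * ∫ y, weight U ε x y ≤ weight U ε x y := by
  have hm := hessSup_pos hε hε'
  have hmε := mul_hessSup_lt hε hε'
  have hpi := Real.pi_pos
  have hα := (alphaMin_spec (ε := ε) hU hR).2 x hx
  -- `σ²` is defined so that the lower Gaussian has exponent `-|y - p|² / (2σ²)`.
  have hB : 1 / sigmaSq U ε = 2 * (1 / (4 * ε) + hessSup U / 2) := by
    rw [sigmaSq]; field_simp; ring
  have hs : 0 < sigmaSq U ε := by rw [sigmaSq]; positivity
  have hC0 : 0 < 1 / (4 * ε) - hessSup U / 2 := by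
    have : 1 / (4 * ε) - hessSup U / 2 = (1 - 2 * hessSup U * ε) / (4 * ε) := by
      field_simp; ring
    rw [this]
    have : 0 < 1 - 2 * hessSup U * ε := by nlinarith
    positivity
  have hZ := integral_weight_le hU hbelow hHess hε hC0 x
  have hw := le_weight_add (ε := ε) hU hHess x (y - x)
  rw [add_sub_cancel] at hw
  set G := ∇ U x
  set m := hessSup U
  set s := sigmaSq U ε
  have hB' : 1 / (4 * ε) + m / 2 = 1 / (2 * s) := by
    have : 1 / (2 * s) = (1 / s) / 2 := by ring
    rw [this, hB]; ring
  set C := 1 / (4 * ε) - m / 2 with hC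
  set p := x - s • G with hp
  have hlow : Real.exp (-U x) * Real.exp (-(1 / s) * ‖y‖ ^ 2 - 1 / s * ‖p‖ ^ 2)
      ≤ weight U ε x y := by
    refine le_trans (mul_le_mul_of_nonneg_left (Real.exp_le_exp.2 ?_) (Real.exp_nonneg _)) hw
    rw [hB', neg_mul_norm_sq_sub_inner (by positivity)]
    have h1 : y - x + (2 * (1 / (2 * s)))⁻¹ • G = y - p := by
      rw [hp]
      have : (2 * (1 / (2 * s)))⁻¹ = s := by field_simp
      rw [this]; abel
    rw [h1]
    -- Decouples `y` from `p`; the price is the doubled exponent in `y`, hence the density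
    -- `e^{-|y|²/σ²}`.
    have h2 : ‖y - p‖ ^ 2 ≤ 2 * ‖y‖ ^ 2 + 2 * ‖p‖ ^ 2 := by
      have := parallelogram_law_with_norm ℝ y p
      nlinarith [mul_self_nonneg ‖y + p‖]
    have h3 : 0 ≤ ‖G‖ ^ 2 / (4 * (1 / (2 * s))) := by positivity
    have h4 : 1 / (2 * s) * ‖y - p‖ ^ 2 ≤ 1 / (2 * s) * (2 * ‖y‖ ^ 2 + 2 * ‖p‖ ^ 2) := by gcongr
    have h5 : 1 / (2 * s) * (2 * ‖y‖ ^ 2 + 2 * ‖p‖ ^ 2)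
        = 1 / s * ‖y‖ ^ 2 + 1 / s * ‖p‖ ^ 2 := by field_simp
    linarith
  refine le_trans ?_ hlow
  set N := (Real.pi / (1 / s)) ^ (d / 2 : ℝ) with hN
  have hN0 : 0 < N := by positivity
  -- Here `2^{-d/2}` in `α` is used up: the ratio of constants becomes `((1 + 2mε) / (1 -
  -- 2mε))^{d/2}`.
  have hratio : (1 / √2) ^ d * N⁻¹ * (Real.pi / C) ^ (d / 2 : ℝ) ≤ Real.exp (3 * ε * (d * m)) := by
    rw [one_div_sqrt_two_pow, hN, ← Real.inv_rpow (by positivity),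
      ← Real.mul_rpow (by positivity) (by positivity),
      ← Real.mul_rpow (by positivity) (by positivity)]
    have e1 : 1 / 2 * (Real.pi / (1 / s))⁻¹ * (Real.pi / C)
        = (1 + 2 * m * ε) / (1 - 2 * m * ε) := by
      have h2 : 1 - 2 * m * ε ≠ 0 := by nlinarith
      have h3 : C = (1 - 2 * m * ε) / (4 * ε) := by rw [hC]; field_simp; ring
      rw [h3, hB]
      field_simp
      ring
    have e2 : 3 * ε * (d * m) = 3 * (2 * m * ε) * (d / 2) := by ring
    have h2 : 0 < 1 - 2 * m * ε := by nlinarith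
    rw [e1, e2]
    refine rpow_half_le_exp (by positivity) ?_ d
    rw [div_le_iff₀ h2]
    have h3 := one_add_le_one_sub_mul_exp (t := 2 * m * ε) (by positivity) (by linarith)
    linarith
  have hG : ‖G‖ ^ 2 / (4 * C) ≤ 2 * ε * ‖G‖ ^ 2 := by
    rw [div_le_iff₀ (mul_pos four_pos hC0)]
    -- This is where `4mε < 1` enters at full strength.
    have : 1 ≤ 2 * ε * (4 * C) := by
      have : 2 * ε * (4 * C) = 2 - 4 * m * ε := by rw [hC]; field_simp
      linarith
    nlinarith [sq_nonneg ‖G‖]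
  have hp0 : 0 ≤ 1 / s * ‖p‖ ^ 2 := by positivity
  calc alphaMin U ε R * (N⁻¹ * Real.exp (-(1 / s) * ‖y‖ ^ 2)) * ∫ y, weight U ε x y
      ≤ ((1 / √2) ^ d * Real.exp (-2 * ε * ‖G‖ ^ 2 - 3 * ε * (d * m) - 2 / s * ‖p‖ ^ 2))
        * (N⁻¹ * Real.exp (-(1 / s) * ‖y‖ ^ 2))
        * (Real.exp (-U x) * ((Real.pi / C) ^ (d / 2 : ℝ) * Real.exp (‖G‖ ^ 2 / (4 * C)))) := by
        refine mul_le_mul (mul_le_mul_of_nonneg_right hα (by positivity)) hZ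
          (integral_nonneg fun y => (weight_pos x y).le) (by positivity)
    _ = ((1 / √2) ^ d * N⁻¹ * (Real.pi / C) ^ (d / 2 : ℝ))
        * Real.exp (-2 * ε * ‖G‖ ^ 2 - 3 * ε * (d * m) - 2 / s * ‖p‖ ^ 2 + ‖G‖ ^ 2 / (4 * C)
          + -(1 / s) * ‖y‖ ^ 2) * Real.exp (-U x) := by
        rw [Real.exp_add, Real.exp_add (_ - _)]; ring
    _ ≤ Real.exp (3 * ε * (d * m))
        * Real.exp (-2 * ε * ‖G‖ ^ 2 - 3 * ε * (d * m) - 2 / s * ‖p‖ ^ 2 + ‖G‖ ^ 2 / (4 * C)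
          + -(1 / s) * ‖y‖ ^ 2) * Real.exp (-U x) :=
        mul_le_mul_of_nonneg_right (mul_le_mul_of_nonneg_right hratio (Real.exp_nonneg _))
          (Real.exp_nonneg _)
    _ ≤ _ := by
        rw [← Real.exp_add, mul_comm]
        refine mul_le_mul_of_nonneg_left (Real.exp_le_exp.2 ?_) (Real.exp_nonneg _)
        have : 2 / s * ‖p‖ ^ 2 = 2 * (1 / s * ‖p‖ ^ 2) := by ring
        linarith

lemma alphaMin_mul_real_le (hU : ContDiff ℝ 2 U) (hbelow : ∀ x, 1 ≤ U x)
    (hHess : BddAbove (Set.range fun x => ‖hessian U x‖)) (hε : 0 < ε)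
    (hε' : ε < 1 / (4 * hessSup U)) {R : ℝ} (hR : 0 < R)
    {x : EuclideanSpace ℝ (Fin d)} (hx : x ∈ Metric.closedBall 0 R)
    {A : Set (EuclideanSpace ℝ (Fin d))} (hA : MeasurableSet A) :
    alphaMin U ε R * (gaussMeasure d (sigmaSq U ε)).real A
      ≤ diffusionMap U ε (A.indicator fun _ => (1 : ℝ)) x := by
  have hm := hessSup_pos hε hε'
  have hs : 0 < sigmaSq U ε := by rw [sigmaSq]; positivity
  have hZ := integral_weight_pos hU.continuous hbelow hε x
  rw [diffusionMap, le_div_iff₀ hZ, gaussMeasure_real hs hA, ← integral_const_mul (alphaMin U ε R),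
    ← integral_mul_const]
  have : ∀ y, weight U ε x y * A.indicator (fun _ => (1 : ℝ)) y
      = A.indicator (fun y => weight U ε x y) y := fun y => by
    by_cases hy : y ∈ A <;> simp [hy]
  simp_rw [this]
  rw [integral_indicator hA]
  refine integral_mono
    (((integrable_gaussMeasure_density hs).integrableOn.const_mul _).mul_const _)
    (integrable_weight hU.continuous hbelow hε x).integrableOn
    fun y => alphaMin_mul_le_weight hU hbelow hHess hε hε' hR hx y

lemma diffusionMap_le_drift (hU : ContDiff ℝ 2 U) (hbelow : ∀ x, 1 ≤ U x)
    (hHess : BddAbove (Set.range fun x => ‖hessian U x‖)) (hε : 0 < ε)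
    (hε' : ε < 1 / (4 * hessSup U)) {lam0 R : ℝ}
    (hdiss : ∀ x, R ≤ ‖x‖ → lam0 * U x + d * hessSup U ≤ 1 / 2 * ‖∇ U x‖ ^ 2)
    (x : EuclideanSpace ℝ (Fin d)) :
    diffusionMap U ε U x ≤ (1 - ε * lam0) * U x
      + ε * bZero U lam0 R * (Metric.closedBall 0 R).indicator (fun _ => (1 : ℝ)) x := by
  have h := diffusionMap_le hU hbelow hHess hε hε' x
  by_cases hx : x ∈ Metric.closedBall 0 R
  · rw [Set.indicator_of_mem hx]
    have := mul_le_mul_of_nonneg_left (le_bZero (lam0 := lam0) hU hx) hε.le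
    linarith
  · rw [Set.indicator_of_notMem hx]
    rw [mem_closedBall_zero_iff, not_le] at hx
    have := mul_le_mul_of_nonneg_left (hdiss x hx.le) hε.le
    linarith

lemma lyapunovConditions (hU : ContDiff ℝ 2 U) (hbelow : ∀ x, 1 ≤ U x)
    (hHess : BddAbove (Set.range fun x => ‖hessian U x‖)) (hε : 0 < ε)
    (hε' : ε < 1 / (4 * hessSup U)) {lam0 R : ℝ} (hlam0 : 0 < lam0) (hR : 0 < R)
    (hdiss : ∀ x, R ≤ ‖x‖ → lam0 * U x + d * hessSup U ≤ 1 / 2 * ‖∇ U x‖ ^ 2) :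
    LyapunovConditions U ε U (ε * lam0) (ε * bZero U lam0 R) (alphaMin U ε R)
      (Metric.closedBall 0 R) (gaussMeasure d (sigmaSq U ε)) where
  measurable_V := hU.continuous.measurable
  one_le_V := hbelow
  lam_pos := by positivity
  alpha_pos := (alphaMin_spec hU hR).1
  measurableSet_K := Metric.isClosed_closedBall.measurableSet
  isProbabilityMeasure := by
    have := hessSup_pos hε hε'
    exact isProbabilityMeasure_gaussMeasure (by rw [sigmaSq]; positivity)
  integrable_V := integrable_weight_mul hU.continuous hbelow hε
  drift := diffusionMap_le_drift hU hbelow hHess hε hε' hdiss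
  minorization A hA x := by
    by_cases hx : x ∈ Metric.closedBall 0 R
    · rw [Set.indicator_of_mem hx, mul_one]
      exact alphaMin_mul_real_le hU hbelow hHess hε hε' hR hx hA
    · rw [Set.indicator_of_notMem hx, mul_zero]
      refine div_nonneg (integral_nonneg fun y => ?_) (integral_nonneg fun y => ?_)
      · exact mul_nonneg (weight_pos x y).le (Set.indicator_nonneg (fun _ _ => zero_le_one) y)
      · exact (weight_pos x y).le

end Weight

/-! ### The transition kernel, its reversibility and positivity, and the spectral gap -/

section SpectralGap

open ProbabilityTheory

variable {U : EuclideanSpace ℝ (Fin d) → ℝ} {ε : ℝ}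

/-- The Markov kernel of transition probabilities of the diffusion map operator. -/
def transitionKernel (U : EuclideanSpace ℝ (Fin d) → ℝ) (ε : ℝ) :
    Kernel (EuclideanSpace ℝ (Fin d)) (EuclideanSpace ℝ (Fin d)) :=
  (Kernel.const _ volume).withDensity
    fun x y => ENNReal.ofReal (weight U ε x y / ∫ y, weight U ε x y)

lemma measurable_integral_weight (hU : Continuous U) :
    Measurable fun x => ∫ y, weight U ε x y :=
  ((continuous_weight (ε := ε) hU).stronglyMeasurable.integral_prod_right).measurable

lemma measurable_invDensity (hU : Continuous U) : Measurable (invDensity U ε) :=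
  (hU.measurable.neg.exp).mul (measurable_integral_weight hU)

lemma transitionKernel_apply (hU : Continuous U) (x : EuclideanSpace ℝ (Fin d)) :
    transitionKernel U ε x = volume.withDensity
      fun y => ENNReal.ofReal (weight U ε x y / ∫ y, weight U ε x y) := by
  rw [transitionKernel, Kernel.withDensity_apply, Kernel.const_apply]
  exact ((continuous_weight hU).measurable.div
    ((measurable_integral_weight hU).comp measurable_fst)).ennreal_ofReal

lemma isMarkovKernel_transitionKernel (hU : Continuous U) (hbelow : ∀ x, 1 ≤ U x) (hε : 0 < ε) :
    IsMarkovKernel (transitionKernel U ε) := by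
  refine ⟨fun x => ⟨?_⟩⟩
  have hZ := integral_weight_pos hU hbelow hε x
  rw [transitionKernel_apply hU, withDensity_apply _ MeasurableSet.univ, setLIntegral_univ,
    ← ofReal_integral_eq_lintegral_ofReal ((integrable_weight hU hbelow hε x).div_const _)
      (ae_of_all _ fun y => div_nonneg (weight_pos x y).le hZ.le), integral_div, div_self hZ.ne',
    ENNReal.ofReal_one]

lemma weight_div_nonneg (x y : EuclideanSpace ℝ (Fin d)) :
    0 ≤ weight U ε x y / ∫ y, weight U ε x y :=
  div_nonneg (weight_pos x y).le (integral_nonneg fun y => (weight_pos x y).le)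

lemma measurable_weight_div (hU : Continuous U) (x : EuclideanSpace ℝ (Fin d)) :
    Measurable fun y => ENNReal.ofReal (weight U ε x y / ∫ y, weight U ε x y) :=
  ((continuous_weight_right hU x).measurable.div_const _).ennreal_ofReal

lemma integral_transitionKernel (hU : Continuous U) (f : EuclideanSpace ℝ (Fin d) → ℝ)
    (x : EuclideanSpace ℝ (Fin d)) : ∫ y, f y ∂(transitionKernel U ε x) = diffusionMap U ε f x := by
  rw [transitionKernel_apply hU, integral_withDensity_eq_integral_toReal_smul
    (measurable_weight_div hU x) (ae_of_all _ fun y => ENNReal.ofReal_lt_top), diffusionMap,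
    ← integral_div]
  congr 1 with y
  rw [ENNReal.toReal_ofReal (weight_div_nonneg x y), smul_eq_mul]
  ring

lemma integrable_transitionKernel (hU : Continuous U) {f : EuclideanSpace ℝ (Fin d) → ℝ}
    {x : EuclideanSpace ℝ (Fin d)} (hf : Integrable fun y => weight U ε x y * f y) :
    Integrable f (transitionKernel U ε x) := by
  rw [transitionKernel_apply hU, integrable_withDensity_iff_integrable_smul'
    (measurable_weight_div hU x) (ae_of_all _ fun y => ENNReal.ofReal_lt_top)]
  refine (hf.div_const (∫ y, weight U ε x y)).congr (ae_of_all _ fun y => ?_)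
  simp only
  rw [ENNReal.toReal_ofReal (weight_div_nonneg x y), smul_eq_mul]
  ring

lemma integrable_exp_neg (hU : Continuous U) {c R : ℝ} (hc : 0 < c)
    (hgrow : ∀ x, 1 + c * (‖x‖ - R) ≤ U x) : Integrable fun x => Real.exp (-U x) := by
  refine ((integrable_exp_neg_mul_norm hc).const_mul (Real.exp (c * R - 1))).mono'
    (by fun_prop) (ae_of_all _ fun x => ?_)
  rw [Real.norm_of_nonneg (Real.exp_nonneg _), ← Real.exp_add, Real.exp_le_exp]
  linarith [hgrow x]

lemma invDensity_pos (hU : Continuous U) (hbelow : ∀ x, 1 ≤ U x) (hε : 0 < ε)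
    (x : EuclideanSpace ℝ (Fin d)) : 0 < invDensity U ε x :=
  mul_pos (Real.exp_pos _) (integral_weight_pos hU hbelow hε x)

lemma integrable_invDensity (hU : Continuous U) (hbelow : ∀ x, 1 ≤ U x) (hε : 0 < ε)
    (hint : Integrable fun x => Real.exp (-U x)) : Integrable (invDensity U ε) := by
  refine (hint.mul_const ((Real.pi / (1 / (4 * ε))) ^ (d / 2 : ℝ))).mono'
    (measurable_invDensity hU).aestronglyMeasurable (ae_of_all _ fun x => ?_)
  rw [Real.norm_of_nonneg (invDensity_pos hU hbelow hε x).le, invDensity,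
    ← integral_gaussKernel_sub hε x]
  refine mul_le_mul_of_nonneg_left ?_ (Real.exp_nonneg _)
  exact integral_mono (integrable_weight hU hbelow hε x) (integrable_gaussKernel_sub hε x)
    fun y => weight_le_gaussKernel hbelow x y

lemma lintegral_invDensity_ne_top (hU : Continuous U) (hbelow : ∀ x, 1 ≤ U x) (hε : 0 < ε)
    (hint : Integrable fun x => Real.exp (-U x)) :
    ∫⁻ x, ENNReal.ofReal (invDensity U ε x) ≠ ∞ :=
  (integrable_invDensity hU hbelow hε hint).lintegral_lt_top.ne

lemma lintegral_invDensity_ne_zero (hU : Continuous U) (hbelow : ∀ x, 1 ≤ U x) (hε : 0 < ε) :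
    ∫⁻ x, ENNReal.ofReal (invDensity U ε x) ≠ 0 := by
  rw [Ne, lintegral_eq_zero_iff (measurable_invDensity hU).ennreal_ofReal]
  intro h
  obtain ⟨x, hx⟩ := h.exists
  exact (ENNReal.ofReal_pos.2 (invDensity_pos hU hbelow hε x)).ne' hx

lemma isProbabilityMeasure_invMeasure (hU : Continuous U) (hbelow : ∀ x, 1 ≤ U x) (hε : 0 < ε)
    (hint : Integrable fun x => Real.exp (-U x)) : IsProbabilityMeasure (invMeasure U ε) := by
  refine ⟨?_⟩
  rw [invMeasure, Measure.smul_apply, withDensity_apply _ MeasurableSet.univ, setLIntegral_univ,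
    smul_eq_mul, ENNReal.inv_mul_cancel (lintegral_invDensity_ne_zero hU hbelow hε)
      (lintegral_invDensity_ne_top hU hbelow hε hint)]

/-- Transfers a.e. measurability of `f ∈ L²(π)` to Lebesgue measure, where the Gaussian form is
evaluated. -/
lemma volume_absolutelyContinuous_invMeasure (hU : Continuous U) (hbelow : ∀ x, 1 ≤ U x)
    (hε : 0 < ε) (hint : Integrable fun x => Real.exp (-U x)) :
    volume ≪ invMeasure U ε := by
  refine (withDensity_absolutelyContinuous' (measurable_invDensity hU).ennreal_ofReal.aemeasurable
    (ae_of_all _ fun x => (ENNReal.ofReal_pos.2 (invDensity_pos hU hbelow hε x)).ne')).trans ?_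
  exact Measure.absolutelyContinuous_smul
    (ENNReal.inv_ne_zero.2 (lintegral_invDensity_ne_top hU hbelow hε hint))

/-- The symmetric joint density `e^{-U(x)} g_ε(x - y) e^{-U(y)}`. -/
def jointDensity (U : EuclideanSpace ℝ (Fin d) → ℝ) (ε : ℝ)
    (p : EuclideanSpace ℝ (Fin d) × EuclideanSpace ℝ (Fin d)) : ℝ :=
  Real.exp (-U p.1) * weight U ε p.1 p.2

lemma jointDensity_swap (p : EuclideanSpace ℝ (Fin d) × EuclideanSpace ℝ (Fin d)) :
    jointDensity U ε p.swap = jointDensity U ε p := by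
  simp only [jointDensity, weight, gaussKernel, Prod.fst_swap, Prod.snd_swap,
    norm_sub_rev p.2 p.1]
  ring

lemma jointDensity_nonneg (p : EuclideanSpace ℝ (Fin d) × EuclideanSpace ℝ (Fin d)) :
    0 ≤ jointDensity U ε p :=
  mul_nonneg (Real.exp_nonneg _) (weight_pos _ _).le

lemma measurable_jointDensity (hU : Continuous U) :
    Measurable fun p => ENNReal.ofReal (jointDensity U ε p) :=
  ((hU.measurable.comp measurable_fst).neg.exp.mul
    (continuous_weight hU).measurable).ennreal_ofReal

lemma invMeasure_compProd_transitionKernel (hU : Continuous U) (hbelow : ∀ x, 1 ≤ U x)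
    (hε : 0 < ε) (hint : Integrable fun x => Real.exp (-U x)) :
    invMeasure U ε ⊗ₘ transitionKernel U ε =
      (∫⁻ x, ENNReal.ofReal (invDensity U ε x))⁻¹ •
        (volume.prod volume).withDensity fun p => ENNReal.ofReal (jointDensity U ε p) := by
  have := isMarkovKernel_transitionKernel hU hbelow hε
  have := isProbabilityMeasure_invMeasure hU hbelow hε hint
  ext s hs
  have hm : Measurable fun x => transitionKernel U ε x (Prod.mk x ⁻¹' s) :=
    Kernel.measurable_kernel_prodMk_left hs
  rw [Measure.compProd_apply hs, invMeasure, lintegral_smul_measure,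
    lintegral_withDensity_eq_lintegral_mul _ (measurable_invDensity hU).ennreal_ofReal hm,
    Measure.smul_apply, withDensity_apply _ hs, ← lintegral_indicator hs,
    lintegral_prod _ ((measurable_jointDensity hU).indicator hs).aemeasurable]
  congr 1
  refine lintegral_congr fun x => ?_
  have hs' : MeasurableSet (Prod.mk x ⁻¹' s) := measurable_prodMk_left hs
  rw [Pi.mul_apply, transitionKernel_apply hU, withDensity_apply _ hs', ← lintegral_indicator hs',
    ← lintegral_const_mul _ ((measurable_weight_div hU x).indicator hs')]
  refine lintegral_congr fun y => ?_
  by_cases hxy : (x, y) ∈ s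
  · have hxy' : y ∈ Prod.mk x ⁻¹' s := hxy
    rw [Set.indicator_of_mem hxy, Set.indicator_of_mem hxy',
      ← ENNReal.ofReal_mul (invDensity_pos hU hbelow hε x).le, jointDensity, invDensity]
    have := (integral_weight_pos hU hbelow hε x).ne'
    congr 1
    field_simp
  · have hxy' : y ∉ Prod.mk x ⁻¹' s := hxy
    rw [Set.indicator_of_notMem hxy, Set.indicator_of_notMem hxy', mul_zero]

lemma measurePreserving_swap_invMeasure (hU : Continuous U) (hbelow : ∀ x, 1 ≤ U x)
    (hε : 0 < ε) (hint : Integrable fun x => Real.exp (-U x)) :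
    MeasurePreserving Prod.swap (invMeasure U ε ⊗ₘ transitionKernel U ε)
      (invMeasure U ε ⊗ₘ transitionKernel U ε) := by
  rw [invMeasure_compProd_transitionKernel hU hbelow hε hint]
  refine MeasurePreserving.smul_measure ⟨measurable_swap, ?_⟩ _
  ext s hs
  rw [Measure.map_apply measurable_swap hs, withDensity_apply _ (measurable_swap hs),
    withDensity_apply _ hs]
  conv_lhs => enter [2, p]; rw [← jointDensity_swap]
  exact Measure.measurePreserving_swap.setLIntegral_comp_preimage hs (measurable_jointDensity hU)

lemma integral_mul_compProd_nonneg (hU : Continuous U) (hbelow : ∀ x, 1 ≤ U x)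
    (hε : 0 < ε) (hint : Integrable fun x => Real.exp (-U x))
    {f : EuclideanSpace ℝ (Fin d) → ℝ} (hf : MemLp f 2 (invMeasure U ε)) :
    0 ≤ ∫ p, f p.1 * f p.2 ∂(invMeasure U ε ⊗ₘ transitionKernel U ε) := by
  have := isMarkovKernel_transitionKernel hU hbelow hε
  have := isProbabilityMeasure_invMeasure hU hbelow hε hint
  have hi := integrable_fst_mul_snd (measurePreserving_swap_invMeasure hU hbelow hε hint) hf hf
  rw [invMeasure_compProd_transitionKernel hU hbelow hε hint] at hi ⊢
  have hI := lintegral_invDensity_ne_zero hU hbelow hε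
  have hI' := lintegral_invDensity_ne_top hU hbelow hε hint
  rw [integrable_smul_measure (ENNReal.inv_ne_zero.2 hI') (ENNReal.inv_ne_top.2 hI),
    integrable_withDensity_iff_integrable_smul' (measurable_jointDensity hU)
    (ae_of_all _ fun y => ENNReal.ofReal_lt_top)] at hi
  rw [integral_smul_measure, integral_withDensity_eq_integral_toReal_smul
    (measurable_jointDensity hU) (ae_of_all _ fun y => ENNReal.ofReal_lt_top)]
  refine smul_nonneg ENNReal.toReal_nonneg ?_
  have key : ∀ p : EuclideanSpace ℝ (Fin d) × EuclideanSpace ℝ (Fin d),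
      (ENNReal.ofReal (jointDensity U ε p)).toReal • (f p.1 * f p.2)
        = (f p.1 * Real.exp (-U p.1)) * Real.exp (-(1 / (4 * ε)) * ‖p.1 - p.2‖ ^ 2)
          * (f p.2 * Real.exp (-U p.2)) := fun p => by
    rw [ENNReal.toReal_ofReal (jointDensity_nonneg p), smul_eq_mul, jointDensity, weight,
      gaussKernel_eq]
    ring
  simp_rw [key] at hi ⊢
  refine integral_prod_exp_nonneg (F := fun x => f x * Real.exp (-U x)) (by positivity) ?_ hi
  exact (hf.aestronglyMeasurable.mono_ac
    (volume_absolutelyContinuous_invMeasure hU hbelow hε hint)).mul (by fun_prop)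

/-- `U` attains its minimum, where `∇U = 0`. Dissipativity fails there, so the point lies in the
ball, and the value under the maximum is positive. -/
lemma bZero_nonneg (hU : ContDiff ℝ 2 U) (hbelow : ∀ x, 1 ≤ U x) (hm : 0 < hessSup U)
    {lam0 R c : ℝ} (hlam0 : 0 < lam0) (hc : 0 < c) (hgrow : ∀ x, 1 + c * (‖x‖ - R) ≤ U x)
    (hdiss : ∀ x, R ≤ ‖x‖ → lam0 * U x + d * hessSup U ≤ 1 / 2 * ‖∇ U x‖ ^ 2) :
    0 ≤ bZero U lam0 R := by
  have hlim : Filter.Tendsto U (Filter.cocompact _) Filter.atTop := by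
    refine Filter.tendsto_atTop_mono hgrow (Filter.tendsto_atTop_add_const_left _ _ ?_)
    exact (Filter.tendsto_atTop_add_const_right _ _ tendsto_norm_cocompact_atTop).const_mul_atTop hc
  obtain ⟨x, hx⟩ := hU.continuous.exists_forall_le hlim
  have h0 : ∇ U x = 0 := by
    have : IsLocalMin U x := Filter.Eventually.of_forall hx
    rw [gradient, this.fderiv_eq_zero, map_zero]
  have hpos : 0 < lam0 * U x + d * hessSup U := by
    have := mul_pos hlam0 (zero_lt_one.trans_le (hbelow x))
    positivity
  have hxR : x ∈ Metric.closedBall 0 R := by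
    rw [mem_closedBall_zero_iff]
    by_contra h
    have := hdiss x (not_le.1 h).le
    rw [h0, norm_zero] at this
    linarith
  have := le_bZero (lam0 := lam0) hU hxR
  rw [h0, norm_zero] at this
  linarith

lemma hasSpectralGap (hU : ContDiff ℝ 2 U) (hbelow : ∀ x, 1 ≤ U x)
    (hHess : BddAbove (Set.range fun x => ‖hessian U x‖)) (hε : 0 < ε)
    (hε' : ε < 1 / (4 * hessSup U)) {lam0 R c : ℝ} (hlam0 : 0 < lam0) (hR : 0 < R) (hc : 0 < c)
    (hgrow : ∀ x, 1 + c * (‖x‖ - R) ≤ U x)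
    (hdiss : ∀ x, R ≤ ‖x‖ → lam0 * U x + d * hessSup U ≤ 1 / 2 * ‖∇ U x‖ ^ 2) :
    HasSpectralGap (invMeasure U ε) (diffusionMap U ε)
      (ε * lam0 / (1 + 2 * ε * bZero U lam0 R / alphaMin U ε R)) := by
  have hUc := hU.continuous
  have hint := integrable_exp_neg hUc hc hgrow
  have := isMarkovKernel_transitionKernel hUc hbelow hε
  have := isProbabilityMeasure_invMeasure hUc hbelow hε hint
  have hrev := measurePreserving_swap_invMeasure hUc hbelow hε hint
  have hL := lyapunovConditions hU hbelow hHess hε hε' hlam0 hR hdiss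
  have := hL.isProbabilityMeasure
  have hα := hL.alpha_pos
  have hb := bZero_nonneg hU hbelow (hessSup_pos hε hε') hlam0 hc hgrow hdiss
  -- At a point outside `K`, which exists because `d ≥ 1`, the drift condition reads `0 < T_ε U ≤ (1
  -- - ε λ₀) U`.
  have hlam1 : ε * lam0 < 1 := by
    have : Nonempty (Fin d) := ⟨⟨0, one_le_dim hε hε'⟩⟩
    obtain ⟨x, hx⟩ := NormedSpace.exists_lt_norm ℝ (EuclideanSpace ℝ (Fin d)) R
    have h1 := hL.drift x
    rw [Set.indicator_of_notMem (by rw [mem_closedBall_zero_iff]; exact not_le.2 hx), mul_zero,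
      add_zero] at h1
    have h2 : 0 < diffusionMap U ε U x := by
      have hZ := integral_weight_pos hUc hbelow hε x
      refine div_pos (hZ.trans_le ?_) hZ
      exact integral_mono (integrable_weight hUc hbelow hε x)
        (integrable_weight_mul hUc hbelow hε x)
        fun y => le_mul_of_one_le_right (weight_pos x y).le (hbelow y)
    have h3 := pos_of_mul_pos_left (h2.trans_le h1) (zero_le_one.trans (hbelow x))
    linarith
  have hT : ∀ f, diffusionMap U ε f = fun x => ∫ y, f y ∂(transitionKernel U ε x) := fun f =>
    funext fun x => (integral_transitionKernel hUc f x).symm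
  have hC : 1 ≤ 1 + 2 * ε * bZero U lam0 R / alphaMin U ε R :=
    le_add_of_nonneg_right (by positivity)
  -- Ensures that `ENNReal.ofReal (1 - β)` is not truncated at `0`.
  have hβ : ε * lam0 / (1 + 2 * ε * bZero U lam0 R / alphaMin U ε R) ≤ 1 := by
    rw [div_le_one (by linarith)]; linarith
  refine ⟨by positivity, fun f hf => ?_, ?_⟩
  · rw [hT]
    exact memLp_integral_kernel hrev hf
  · have hle : normL20 (invMeasure U ε) (diffusionMap U ε) ≤ ENNReal.ofReal
        (1 - ε * lam0 / (1 + 2 * ε * bZero U lam0 R / alphaMin U ε R)) := by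
      refine iSup_le fun f => iSup_le fun hf => iSup_le fun hf0 => ?_
      refine ENNReal.div_le_of_le_mul ?_
      rw [hT, mul_assoc 2]
      refine eLpNorm_integral_kernel_le_of_drift_of_minorization hrev
        (fun f hf => integral_mul_compProd_nonneg hUc hbelow hε hint hf) hL.measurable_V hL.one_le_V
        (fun x => integrable_transitionKernel hUc (hL.integrable_V x)) hL.lam_pos.le hlam1
        (by positivity) hα hL.measurableSet_K (fun x => ?_) (ν := gaussMeasure d (sigmaSq U ε))
        (fun A hA x hx => ?_) hf hf0
      · rw [integral_transitionKernel hUc]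
        exact hL.drift x
      · have h := hL.minorization A hA x
        rw [Set.indicator_of_mem hx, mul_one, ← integral_transitionKernel hUc,
          integral_indicator hA, setIntegral_const, smul_eq_mul, mul_one] at h
        exact h
    calc (normL20 (invMeasure U ε) (diffusionMap U ε) : EReal)
        ≤ (ENNReal.ofReal
          (1 - ε * lam0 / (1 + 2 * ε * bZero U lam0 R / alphaMin U ε R)) : EReal) :=
          EReal.coe_ennreal_le_coe_ennreal_iff.2 hle
      _ = _ := by rw [EReal.coe_ennreal_ofReal, max_eq_left (by linarith)]

/-- Since `U ≥ 1`, dissipativity gives `|∇U|² ≥ 2 λ₀ > λ₀` outside the ball. -/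
lemma linear_growth (hU : ContDiff ℝ 2 U) (hbelow : ∀ x, 1 ≤ U x) {lam0 R C : ℝ}
    (hlam0 : 0 < lam0) (hC : 0 ≤ C)
    (hdiss : ∀ x, R ≤ ‖x‖ → lam0 * U x + C ≤ 1 / 2 * ‖∇ U x‖ ^ 2)
    (x : EuclideanSpace ℝ (Fin d)) : 1 + √lam0 * (‖x‖ - R) ≤ U x := by
  refine one_add_mul_le_of_lt_norm_gradient hU hbelow (Real.sqrt_pos.2 hlam0) (fun y hy => ?_) x
  refine lt_of_pow_lt_pow_left₀ 2 (norm_nonneg _) ?_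
  rw [Real.sq_sqrt hlam0.le]
  have := le_mul_of_one_le_right hlam0.le (hbelow y)
  linarith [hdiss y hy]

end SpectralGap

end DiffusionMap

end

theorem proposition3 (d : ℕ) (U : EuclideanSpace ℝ (Fin d) → ℝ)
    (hU : ContDiff ℝ 2 U) (hbelow : ∀ x, 1 ≤ U x)
    (hHess : BddAbove (Set.range fun x => ‖DiffusionMap.hessian U x‖))
    (lam0 R : ℝ) (hlam0 : 0 < lam0) (hR : 0 < R)
    (ε : ℝ) (hε : 0 < ε) (hε' : ε < 1 / (4 * DiffusionMap.hessSup U)) :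
    -- dissipativity with the constant `d ‖∇²U‖_∞`: explicit constants
    ((∀ x, R ≤ ‖x‖ → lam0 * U x + d * DiffusionMap.hessSup U ≤ 1 / 2 * ‖∇ U x‖ ^ 2) →
      IsProbabilityMeasure (DiffusionMap.invMeasure U ε) ∧
      (∃ ν : Measure (EuclideanSpace ℝ (Fin d)),
        DiffusionMap.LyapunovConditions U ε U (ε * lam0) (ε * DiffusionMap.bZero U lam0 R)
          (DiffusionMap.alphaMin U ε R) (Metric.closedBall 0 R) ν) ∧
      DiffusionMap.HasSpectralGap (DiffusionMap.invMeasure U ε) (DiffusionMap.diffusionMap U ε)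
        (ε * lam0 /
          (1 + 2 * ε * DiffusionMap.bZero U lam0 R / DiffusionMap.alphaMin U ε R))) ∧
    -- dissipativity with the constant `‖∇²U‖_∞`: the same for each `lam1 < lam0` and some `r ≥ R`
    ((∀ x, R ≤ ‖x‖ → lam0 * U x + DiffusionMap.hessSup U ≤ 1 / 2 * ‖∇ U x‖ ^ 2) →
      IsProbabilityMeasure (DiffusionMap.invMeasure U ε) ∧
      ∀ lam1 : ℝ, 0 < lam1 → lam1 < lam0 → ∃ r : ℝ, R ≤ r ∧
        (∃ ν : Measure (EuclideanSpace ℝ (Fin d)),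
          DiffusionMap.LyapunovConditions U ε U (ε * lam1) (ε * DiffusionMap.bZero U lam1 r)
            (DiffusionMap.alphaMin U ε r) (Metric.closedBall 0 r) ν) ∧
        DiffusionMap.HasSpectralGap (DiffusionMap.invMeasure U ε) (DiffusionMap.diffusionMap U ε)
          (ε * lam1 /
            (1 + 2 * ε * DiffusionMap.bZero U lam1 r / DiffusionMap.alphaMin U ε r))) := by
  have hm := DiffusionMap.hessSup_pos hε hε'
  constructor
  · intro hdiss
    have hgrow := DiffusionMap.linear_growth hU hbelow hlam0 (by positivity) hdiss
    have hs := Real.sqrt_pos.2 hlam0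
    exact ⟨DiffusionMap.isProbabilityMeasure_invMeasure hU.continuous hbelow hε
        (DiffusionMap.integrable_exp_neg hU.continuous hs hgrow),
      ⟨_, DiffusionMap.lyapunovConditions hU hbelow hHess hε hε' hlam0 hR hdiss⟩,
      DiffusionMap.hasSpectralGap hU hbelow hHess hε hε' hlam0 hR hs hgrow hdiss⟩
  · intro hdiss
    have hgrow := DiffusionMap.linear_growth hU hbelow hlam0 hm.le hdiss
    have hs := Real.sqrt_pos.2 hlam0
    refine ⟨DiffusionMap.isProbabilityMeasure_invMeasure hU.continuous hbelow hε
        (DiffusionMap.integrable_exp_neg hU.continuous hs hgrow), fun lam1 hlam1 hlt => ?_⟩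
    -- Chosen so that `(λ₀ - λ₁) √λ₀ t = d m`: beyond radius `R + t` linear growth gives `(λ₀ - λ₁)
    -- U ≥ d m`, which reduces to the hypothesis of the first part with `λ₁`.
    set t := d * DiffusionMap.hessSup U / (√lam0 * (lam0 - lam1)) with ht
    have hlt' : 0 < lam0 - lam1 := sub_pos.2 hlt
    have ht0 : 0 ≤ t := by positivity
    have hdiss1 : ∀ x, R + t ≤ ‖x‖ →
        lam1 * U x + d * DiffusionMap.hessSup U ≤ 1 / 2 * ‖∇ U x‖ ^ 2 := fun x hx => by
      have h1 := hdiss x (by linarith)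
      have h2 : √lam0 * t ≤ √lam0 * (‖x‖ - R) := by
        refine mul_le_mul_of_nonneg_left ?_ hs.le
        linarith
      have h3 := mul_le_mul_of_nonneg_left (h2.trans (by linarith [hgrow x] : _ ≤ U x)) hlt'.le
      have h4 : (lam0 - lam1) * (√lam0 * t) = d * DiffusionMap.hessSup U := by
        rw [ht]; field_simp
      linarith
    have hgrow1 := DiffusionMap.linear_growth hU hbelow hlam1 (by positivity) hdiss1
    have hR1 : 0 < R + t := by positivity
    exact ⟨R + t, by linarith,
      ⟨_, DiffusionMap.lyapunovConditions hU hbelow hHess hε hε' hlam1 hR1 hdiss1⟩,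
      DiffusionMap.hasSpectralGap hU hbelow hHess hε hε' hlam1 hR1 (Real.sqrt_pos.2 hlam1) hgrow1
        hdiss1⟩
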